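/- A robot is a deterministic finite automaton on the pixels of the grid $\mathbb{Z}^2$, each of which is empty or occupied by a tile. In each step it reads its state and whether its current pixel is occupied, and then either terminates, or changes its state, sets the current pixel to empty or occupied, and moves one unit up, down, left or right. A polyomino is a finite, non-empty, edge-connected set $P\subset\mathbb{Z}^2$ of tiles (possibly with holes) in which any two diagonally adjacent tiles have a common edge-neighbor in $P$. Its boundary $\partial P$ consists of all tiles of $P$ that share an edge or a corner with an empty pixel. Let $R$ be the smallest axis-parallel rectangle of pixels containing $P$. A zig-zag bounding box of $P$ is a closed cycle of tiles, each touching the next only at a corner, that lies on the two rectangular lanes of pixels at distances $2$ (inner lane) and $3$ (outer lane) around $R$, such that along each side the tiles alternate between the two lanes, and every edge-connected path of pixels from $P$ to the exterior of the lanes meets a tile of the cycle. Theorem. There are a robot (with a fixed finite set of states) and a constant $C$ such that the following holds for every polyomino $P$ of width $w$ and height $h$. Started on an arbitrary tile of $P$, with the tiles of $P$ being the only tiles, the robot terminates after at most $C\cdot\max(w,h)\cdot wh$ steps, and the tiles are then exactly those of $P$ together with a zig-zag bounding box of $P$. At any time there are at most $|P|+C\,|\partial P|$ tiles on the grid, and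 in total the robot visits at most $C\,(w+h)$ pixels outside $R$. Moreover, in the best case the running time is $O(wh)$: for every polyomino $P$ there is a tile of $P$ from which the robot terminates after at most $C\cdot wh$ steps. -/

import Mathlib

/-! ## Pixels and polyominoes -/

/-- The nodes of the infinite square grid. -/
abbrev Pixel : Type := ℤ × ℤ

/-- The infinite grid: edges between all pairs of pixels at unit distance. -/
def gridGraph : SimpleGraph Pixel where
  Adj p q := |p.1 - q.1| + |p.2 - q.2| = 1
  symm := ⟨fun p q h => by rw [abs_sub_comm q.1, abs_sub_comm q.2]; exact h⟩
  loopless := ⟨fun p h => by simp at h⟩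

/-- Two pixels that share exactly a corner. -/
def IsDiagonalPair (p q : Pixel) : Prop :=
  |p.1 - q.1| = 1 ∧ |p.2 - q.2| = 1

/-- A polyomino: a finite, connected (in particular nonempty) set of pixels in which every
diagonal pair has a common neighbour belonging to the set. Holes are allowed. -/
structure IsPolyomino (P : Finset Pixel) : Prop where
  connected : (gridGraph.induce (P : Set Pixel)).Connected
  diagonal : ∀ p ∈ P, ∀ q ∈ P, IsDiagonalPair p q →
    ∃ r ∈ P, gridGraph.Adj r p ∧ gridGraph.Adj r q

open Classical in
/-- The boundary of `P`: all tiles of `P` that are adjacent to an empty pixel or build a diagonal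
pair with an empty pixel. -/
noncomputable def boundary (P : Finset Pixel) : Finset Pixel :=
  P.filter fun p => ∃ q, q ∉ P ∧ (gridGraph.Adj p q ∨ IsDiagonalPair p q)

/-- Extremal coordinates of the tiles of `P` (used for nonempty `P` only). -/
noncomputable def xMin (P : Finset Pixel) : ℤ := sInf (Prod.fst '' (P : Set Pixel))
noncomputable def xMax (P : Finset Pixel) : ℤ := sSup (Prod.fst '' (P : Set Pixel))
noncomputable def yMin (P : Finset Pixel) : ℤ := sInf (Prod.snd '' (P : Set Pixel))
noncomputable def yMax (P : Finset Pixel) : ℤ := sSup (Prod.snd '' (P : Set Pixel))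

/-- Number of columns, respectively rows, that `P` spans. -/
noncomputable def width (P : Finset Pixel) : ℕ := (xMax P - xMin P + 1).toNat
noncomputable def height (P : Finset Pixel) : ℕ := (yMax P - yMin P + 1).toNat

/-- The smallest axis-parallel rectangle of pixels that contains `P`, enlarged by `k` on every
side. In particular `rect P 0` is the bounding rectangle of `P`. -/
def rect (P : Finset Pixel) (k : ℤ) : Set Pixel :=
  {p | xMin P - k ≤ p.1 ∧ p.1 ≤ xMax P + k ∧ yMin P - k ≤ p.2 ∧ p.2 ≤ yMax P + k}

/-! ## Zig-zag bounding boxes -/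

/-- The inner lane: the closed rectangular lane at distance two from the bounding rectangle, so
that one lane of empty pixels remains around the rectangle. -/
def innerLane (P : Finset Pixel) : Set Pixel := rect P 2 \ rect P 1

/-- The outer lane: the next lane around the inner lane. -/
def outerLane (P : Finset Pixel) : Set Pixel := rect P 3 \ rect P 2

/-- The four corner pixels of the outer lane. -/
def IsOuterCorner (P : Finset Pixel) (p : Pixel) : Prop :=
  (p.1 = xMin P - 3 ∨ p.1 = xMax P + 3) ∧ (p.2 = yMin P - 3 ∨ p.2 = yMax P + 3)

/-- `B` is a zig-zag bounding box around `P`. Its tiles lie on the inner and on the outer lane; of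
the pixels on these two lanes (except the outer corners) it contains exactly those of one colour
class of the chessboard colouring. So on each of the four sides the tiles alternate between the
two lanes, consecutive tiles are diagonal pairs, no two tiles share a side, and at the corners the
four sides are joined diagonally to one closed path. Moreover `B` encloses `P`: every walk in the
grid from `P` to the exterior of the box runs through a tile of `B`. -/
structure IsZigZagBoundingBox (P B : Finset Pixel) : Prop where
  zigzag : ∃ e : ℤ, ∀ p : Pixel, p ∈ B ↔
    (p ∈ innerLane P ∨ p ∈ outerLane P ∧ ¬ IsOuterCorner P p) ∧ Even (p.1 + p.2 + e)
  encloses : ∀ p ∈ P, ∀ q, q ∉ rect P 3 → ∀ W : gridGraph.Walk p q, ∃ r ∈ W.support, r ∈ B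

/-! ## The robot -/

inductive Dir : Type
  | up | down | left | right

/-- The pixel reached from `p` by one move in direction `d`. -/
def Dir.move : Dir → Pixel → Pixel
  | .up, p => (p.1, p.2 + 1)
  | .down, p => (p.1, p.2 - 1)
  | .left, p => (p.1 - 1, p.2)
  | .right, p => (p.1 + 1, p.2)

/-- A robot with state set `Q` (required to be finite where robots are used). From its state and
the state of the current pixel (`true` = occupied) the transition function either terminates
(`none`) or yields a new robot state, a new state of the current pixel and a direction to move. -/
structure Robot (Q : Type) where
  start : Q
  δ : Q → Bool → Option (Q × Bool × Dir)

/-- A configuration: the robot's state and location, and the set of occupied pixels. -/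
structure Config (Q : Type) where
  state : Q
  pos : Pixel
  tiles : Finset Pixel

namespace Robot

variable {Q : Type}

/-- One look-compute-move step; `none` if the robot has terminated. -/
def step (M : Robot Q) (c : Config Q) : Option (Config Q) :=
  (M.δ c.state (decide (c.pos ∈ c.tiles))).map fun a =>
    { state := a.1
      pos := a.2.2.move c.pos
      tiles := if a.2.1 then insert c.pos c.tiles else c.tiles.erase c.pos }

/-- The configuration after `t` steps (or after termination, if this happens earlier), when the
robot is started on pixel `s` in an arrangement of tiles `P`. -/
def run (M : Robot Q) (P : Finset Pixel) (s : Pixel) : ℕ → Config Q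
  | 0 => { state := M.start, pos := s, tiles := P }
  | t + 1 => (M.step (M.run P s t)).getD (M.run P s t)

/-- The robot, started on `s` in `P`, has terminated after at most `t` steps. -/
def HaltedAt (M : Robot Q) (P : Finset Pixel) (s : Pixel) (t : ℕ) : Prop :=
  M.step (M.run P s t) = none

/-- All pixels that the robot visits outside the bounding rectangle of the input. -/
def extraSpace (M : Robot Q) (P : Finset Pixel) (s : Pixel) : Set Pixel :=
  {p | p ∉ rect P 0 ∧ ∃ t, (M.run P s t).pos = p}

end Robot

/-! The robot keeps a growing rectangle that contains its start tile and lies in the bounding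
rectangle. The grid itself remembers this rectangle: a marker sits outside each of its four corners.
A marker is a two by two chessboard square, which the diagonal condition forbids in `P`. It can be
put over arbitrary tiles reversibly: a ten by ten block of `P` consists of 25 squares with 14
possible patterns each, and `14 ^ 25 ≤ 2 ^ 96`, so its content fits into the 96 cells left beside
the marker (`nonempty_plainBlock_embedding`, `decode_encode`).

The robot walks along the adjacent lane with the rectangle on its left, and pushes a side outwards
when the lane along it contains a tile. A phase pushes two opposite sides as far as possible; the
next phase treats the other two (`reach_phase`). When a phase pushes nothing, all four lanes are
empty and connectedness confines `P` to the rectangle (`Inside.encloses`). Each new row costs time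
proportional to its length, in total `O(wh)`. Productive phases alternate between the two
directions, so there are `O(min(w, h))` phases, each with an overhead of `O(w + h)`
(`reach_rectangle`). Hence `O(wh)` steps suffice from every start tile, which covers both the
general bound and the best case.

One more round writes one colour class of the chessboard on the lanes at distances two and three; by
then the markers hide no tile and are overwritten (`reach_box`). A path that leaves the inner lane
steps between two pixels of opposite colours, one of which is occupied (`isZigZagBoundingBox`).

All this is programmed for a robot that sees and rewrites a whole window. An ordinary robot
simulates each such step by two tours of constant length through the window
(`WindowRobot.exists_robot`). The additional tiles always lie in a ring of constant thickness around
the current rectangle and in one window, and they are few because every row and column contains a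
boundary tile (`card_boundary`). -/

/-! ## Reachability within a number of steps -/

/-- `Reach step I n a b`: exactly `n` steps lead from `a` to `b`, and `I` holds all along. -/
inductive Reach {α : Type*} (step : α → Option α) (I : α → Prop) : ℕ → α → α → Prop
  | refl {a : α} : I a → Reach step I 0 a a
  | cons {n : ℕ} {a b c : α} :
      I a → step a = some b → Reach step I n b c → Reach step I (n + 1) a c

namespace Reach

variable {α : Type*} {step : α → Option α} {I : α → Prop}

theorem left {n : ℕ} {a b : α} (h : Reach step I n a b) : I a := by
  cases h <;> assumption

theorem trans {n m : ℕ} {a b c : α} (h : Reach step I n a b) (h' : Reach step I m b c) :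
    Reach step I (n + m) a c := by
  induction h with
  | refl _ => simpa using h'
  | @cons n _ _ _ ha hs _ ih =>
    have := Reach.cons ha hs (ih h')
    rwa [show n + 1 + m = n + m + 1 by omega]

end Reach

/-- `ReachLe step I N a b`: at most `N` steps lead from `a` to `b`, and `I` holds all along. -/
def ReachLe {α : Type*} (step : α → Option α) (I : α → Prop) (N : ℕ) (a b : α) : Prop :=
  ∃ n ≤ N, Reach step I n a b

namespace ReachLe

variable {α : Type*} {step : α → Option α} {I : α → Prop}

theorem refl {a : α} (h : I a) : ReachLe step I 0 a a := ⟨0, le_rfl, .refl h⟩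

theorem cons {N : ℕ} {a b c : α} (ha : I a) (hs : step a = some b) (h : ReachLe step I N b c) :
    ReachLe step I (N + 1) a c := by
  obtain ⟨n, hn, hr⟩ := h
  exact ⟨n + 1, by omega, .cons ha hs hr⟩

theorem trans {n m : ℕ} {a b c : α} (h : ReachLe step I n a b) (h' : ReachLe step I m b c) :
    ReachLe step I (n + m) a c := by
  obtain ⟨k, hk, hr⟩ := h
  obtain ⟨l, hl, hr'⟩ := h'
  exact ⟨k + l, by omega, hr.trans hr'⟩

theorem mono {n m : ℕ} {a b : α} (h : ReachLe step I n a b) (hnm : n ≤ m) :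
    ReachLe step I m a b := by
  obtain ⟨k, hk, hr⟩ := h
  exact ⟨k, by omega, hr⟩

end ReachLe

namespace Robot

variable {Q : Type}

theorem run_add_of_reach (M : Robot Q) {I : Config Q → Prop} {P : Finset Pixel} {s : Pixel}
    {n : ℕ} {c c' : Config Q} (h : Reach M.step I n c c') :
    ∀ t₀, M.run P s t₀ = c → M.run P s (t₀ + n) = c' ∧ ∀ t ≤ n, I (M.run P s (t₀ + t)) := by
  induction h with
  | refl hI =>
    intro t₀ h₀
    refine ⟨h₀, fun t ht => ?_⟩
    obtain rfl : t = 0 := by omega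
    simpa [h₀] using hI
  | @cons n a b c ha hs _ ih =>
    intro t₀ h₀
    have h1 : M.run P s (t₀ + 1) = b := by
      simp [run, h₀, hs]
    obtain ⟨h2, h3⟩ := ih (t₀ + 1) h1
    refine ⟨by rw [← h2]; congr 1; omega, fun t ht => ?_⟩
    rcases t with _ | t
    · simpa [h₀] using ha
    · have := h3 t (by omega)
      rwa [show t₀ + (t + 1) = t₀ + 1 + t by omega]

/-- After termination the configuration is constant, so an invariant of the finite path holds at all
times. -/
theorem run_of_reach (M : Robot Q) {I : Config Q → Prop} {P : Finset Pixel} {s : Pixel}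
    {n : ℕ} {c' : Config Q} (h : Reach M.step I n (M.run P s 0) c') (hc : M.step c' = none) :
    M.HaltedAt P s n ∧ M.run P s n = c' ∧ ∀ t, I (M.run P s t) := by
  obtain ⟨h1, h2⟩ := M.run_add_of_reach h 0 rfl
  simp only [Nat.zero_add] at h1 h2
  have stay : ∀ k, M.run P s (n + k) = c' := by
    intro k
    induction k with
    | zero => exact h1
    | succ k ih => rw [← Nat.add_assoc, run, ih, hc]; rfl
  refine ⟨by rw [HaltedAt, h1, hc], h1, fun t => ?_⟩
  rcases le_total t n with ht | ht
  · exact h2 t ht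
  · obtain ⟨k, rfl⟩ := Nat.exists_eq_add_of_le ht
    rw [stay k, ← h1]
    exact h2 n le_rfl

end Robot

/-! ## Robots that see and rewrite a whole window of pixels -/

/-- The offsets of the pixels in the window of radius `K`. -/
noncomputable def window (K : ℤ) : Finset Pixel := Finset.Icc (-K, -K) (K, K)

theorem mem_window {K : ℤ} {z : Pixel} :
    z ∈ window K ↔ -K ≤ z.1 ∧ z.1 ≤ K ∧ -K ≤ z.2 ∧ z.2 ≤ K := by
  simp only [window, Finset.mem_Icc, Prod.le_def]
  tauto

/-- A robot that in each step reads and rewrites all pixels at distance at most `K`. -/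
structure WindowRobot (Q : Type) where
  radius : ℤ
  δ : Q → (Pixel → Bool) → Option (Q × (Pixel → Bool) × Dir)

/-- A configuration of a window robot. -/
structure World (Q : Type) where
  state : Q
  pos : Pixel
  grid : Pixel → Bool

/-- What a robot at `a` sees of the grid. -/
noncomputable def view (K : ℤ) (a : Pixel) (g : Pixel → Bool) : Pixel → Bool :=
  fun z => if z ∈ window K then g (a + z) else false

/-- The grid after the window around `a` has been overwritten by `W`. -/
noncomputable def overwrite (K : ℤ) (a : Pixel) (W g : Pixel → Bool) : Pixel → Bool :=
  fun p => if p - a ∈ window K then W (p - a) else g p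

namespace WindowRobot

variable {Q : Type}

noncomputable def step (M : WindowRobot Q) (c : World Q) : Option (World Q) :=
  (M.δ c.state (view M.radius c.pos c.grid)).map fun r =>
    { state := r.1
      pos := r.2.2.move c.pos
      grid := overwrite M.radius c.pos r.2.1 c.grid }

end WindowRobot

/-! ## Closed tours through a window -/

theorem Dir.move_add (d : Dir) (p q : Pixel) : d.move (p + q) = p + d.move q := by
  cases d <;> ext <;> simp [Dir.move] <;> ring

instance : Finite Dir :=
  Finite.of_surjective (fun i : Fin 4 => match i with
    | 0 => Dir.up | 1 => Dir.down | 2 => Dir.left | 3 => Dir.right) fun d => by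
      cases d
      exacts [⟨0, rfl⟩, ⟨1, rfl⟩, ⟨2, rfl⟩, ⟨3, rfl⟩]

instance : Inhabited Dir := ⟨.up⟩

/-- The pixel where the path with the given moves ends. -/
def follow (l : List Dir) (p : Pixel) : Pixel := l.foldl (fun q d => d.move q) p

theorem follow_append (l l' : List Dir) (p : Pixel) :
    follow (l ++ l') p = follow l' (follow l p) := List.foldl_append

theorem follow_concat (l : List Dir) (d : Dir) (p : Pixel) :
    follow (l ++ [d]) p = d.move (follow l p) := by simp [follow]

theorem exists_follow (p q : Pixel) : ∃ l, follow l p = q := by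
  have hor : ∀ n : ℕ, ∀ p : Pixel, (∃ l, follow l p = (p.1 + n, p.2)) ∧
      (∃ l, follow l p = (p.1 - n, p.2)) ∧ (∃ l, follow l p = (p.1, p.2 + n)) ∧
      (∃ l, follow l p = (p.1, p.2 - n)) := by
    intro n
    induction n with
    | zero => intro p; exact ⟨⟨[], by simp [follow]⟩, ⟨[], by simp [follow]⟩,
        ⟨[], by simp [follow]⟩, ⟨[], by simp [follow]⟩⟩
    | succ n ih =>
      intro p
      obtain ⟨⟨l1, h1⟩, ⟨l2, h2⟩, ⟨l3, h3⟩, ⟨l4, h4⟩⟩ := ih p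
      refine ⟨⟨l1 ++ [.right], ?_⟩, ⟨l2 ++ [.left], ?_⟩, ⟨l3 ++ [.up], ?_⟩,
        ⟨l4 ++ [.down], ?_⟩⟩ <;>
      simp only [follow_concat, h1, h2, h3, h4, Dir.move] <;> ext <;> push_cast <;> ring
  have h1 : ∃ l, follow l p = (q.1, p.2) := by
    rcases le_total p.1 q.1 with h | h
    · obtain ⟨l, hl⟩ := (hor (q.1 - p.1).toNat p).1
      exact ⟨l, by rw [hl]; ext <;> simp; omega⟩
    · obtain ⟨l, hl⟩ := (hor (p.1 - q.1).toNat p).2.1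
      exact ⟨l, by rw [hl]; ext <;> simp; omega⟩
  have h2 : ∃ l, follow l (q.1, p.2) = q := by
    rcases le_total p.2 q.2 with h | h
    · obtain ⟨l, hl⟩ := (hor (q.2 - p.2).toNat (q.1, p.2)).2.2.1
      exact ⟨l, by rw [hl]; ext <;> simp; omega⟩
    · obtain ⟨l, hl⟩ := (hor (p.2 - q.2).toNat (q.1, p.2)).2.2.2
      exact ⟨l, by rw [hl]; ext <;> simp; omega⟩
  obtain ⟨l1, h1⟩ := h1
  obtain ⟨l2, h2⟩ := h2
  exact ⟨l1 ++ l2, by rw [follow_append, h1, h2]⟩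

/-- Detours to the pixels of `S` are concatenated, each returning to the origin. -/
theorem exists_tour (S : Finset Pixel) :
    ∃ l : List Dir, follow l 0 = 0 ∧ ∀ z ∈ S, ∃ i < l.length, follow (l.take i) 0 = z := by
  induction S using Finset.induction_on with
  | empty => exact ⟨[], rfl, by simp⟩
  | insert z S _ ih =>
    obtain ⟨l, h0, hl⟩ := ih
    obtain ⟨l1, h1⟩ := exists_follow 0 z
    obtain ⟨l2, h2⟩ := exists_follow (Dir.up.move z) 0
    -- The extra move up guarantees that `z` is visited strictly before the end of the tour, even if
    -- `l1` is empty.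
    refine ⟨l ++ (l1 ++ (Dir.up :: l2)), ?_, ?_⟩
    · rw [follow_append, h0, follow_append, h1]; exact h2
    · intro y hy
      rcases Finset.mem_insert.1 hy with rfl | hy
      · refine ⟨l.length + l1.length, by simp, ?_⟩
        rw [List.take_length_add_append, List.take_left, follow_append, h0, h1]
      · obtain ⟨i, hi, he⟩ := hl y hy
        refine ⟨i, by simp; omega, ?_⟩
        rwa [List.take_append_of_le_length hi.le]

theorem abs_follow_le (l : List Dir) :
    |(follow l 0).1| ≤ l.length ∧ |(follow l 0).2| ≤ l.length := by
  induction l using List.reverseRecOn with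
  | nil => simp [follow]
  | append_singleton l d ih =>
    rw [follow_concat]
    simp only [abs_le, List.length_append, List.length_singleton] at ih ⊢
    push_cast
    cases d <;> simp only [Dir.move] <;> omega

/-! ## Simulation of a window robot by a robot -/

/-- States of the simulating robot: the first kind reads the window along a tour, the second kind
rewrites it along the same tour. The last component counts the moves made on the tour. -/
abbrev TourState (Q : Type) (K : ℤ) (n : ℕ) : Type :=
  Q × (window K → Bool) × Fin (n + 1) ⊕ Q × (window K → Bool) × Dir × Fin (n + 1)

namespace WindowRobot

variable {Q : Type} (M : WindowRobot Q) (l : List Dir)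

/-- The memory as a partial picture of the window. -/
noncomputable def picture {K : ℤ} (m : window K → Bool) : Pixel → Bool :=
  fun z => if h : z ∈ window K then m ⟨z, h⟩ else false

/-- One step of the rewriting tour. -/
noncomputable def writeAct (q : Q) (m : window M.radius → Bool) (d : Dir)
    (i : Fin (l.length + 1)) (b : Bool) : TourState Q M.radius l.length × Bool × Dir :=
  let b' := if h : follow (l.take i) 0 ∈ window M.radius then m ⟨_, h⟩ else b
  if h : (i : ℕ) < l.length then
    (.inr (q, m, d, ⟨i + 1, by omega⟩), b', l[(i : ℕ)])
  else (.inl (q, fun _ => false, 0), b', d)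

open Classical in
/-- The robot that simulates `M` with the tour `l`. -/
noncomputable def toRobot (q₀ : Q) : Robot (TourState Q M.radius l.length) where
  start := .inl (q₀, fun _ => false, 0)
  δ s b := match s with
    | .inl (q, m, i) =>
      if h : (i : ℕ) < l.length then
        some (.inl (q, fun z => if z.1 = follow (l.take i) 0 then b else m z, ⟨i + 1, by omega⟩),
          b, l[(i : ℕ)])
      else (M.δ q (picture m)).map fun r => M.writeAct l r.1 (fun z => r.2.1 z) r.2.2 0 b
    | .inr (q, m, d, i) => some (M.writeAct l q m d i b)

/-- A configuration of the simulating robot that is about to simulate a step from `c`. -/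
structure Simulates (c : Config (TourState Q M.radius l.length)) (w : World Q) : Prop where
  state : ∃ m, c.state = .inl (w.state, m, 0)
  pos : c.pos = w.pos
  tiles : ∀ p, p ∈ c.tiles ↔ w.grid p = true

/-- `c` differs from `w` only within distance `n` of the position. -/
structure Near {Q' : Type} (n : ℤ) (c : Config Q') (w : World Q) : Prop where
  pos : |c.pos.1 - w.pos.1| ≤ n ∧ |c.pos.2 - w.pos.2| ≤ n
  tiles : ∀ p ∈ c.tiles, w.grid p = true ∨ p - w.pos ∈ window n

variable {M l}

theorem follow_take_succ {i : ℕ} (h : i < l.length) :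
    follow (l.take (i + 1)) 0 = (l[i]).move (follow (l.take i) 0) := by
  rw [List.take_succ_eq_append_getElem h, follow_concat]

theorem near_of_follow {N : ℤ} {Q' : Type} {c : Config Q'} {w : World Q} {i : ℕ}
    (hK : M.radius ≤ N) (hN : (l.length : ℤ) ≤ N)
    (hp : c.pos = w.pos + follow (l.take i) 0)
    (ht : ∀ p ∈ c.tiles, w.grid p = true ∨ p - w.pos ∈ window M.radius) : Near N c w := by
  constructor
  · obtain ⟨h1, h2⟩ := abs_follow_le (l.take i)
    have : ((l.take i).length : ℤ) ≤ l.length := by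
      exact_mod_cast List.length_take_le' i l
    rw [hp]
    simp only [Prod.fst_add, Prod.snd_add, add_sub_cancel_left]
    omega
  · intro p hp
    refine (ht p hp).imp_right fun h => ?_
    rw [mem_window] at h ⊢
    omega

section

variable {q₀ : Q} {I : World Q → Prop} {I' : Config (TourState Q M.radius l.length) → Prop}
  {w : World Q} {c : Config (TourState Q M.radius l.length)}

/-- The reading tour. -/
theorem reach_read (h0 : follow l 0 = 0)
    (hl : ∀ z ∈ window M.radius, ∃ i < l.length, follow (l.take i) 0 = z)
    (hI : ∀ (c : Config (TourState Q M.radius l.length)) (i : ℕ),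
      c.pos = w.pos + follow (l.take i) 0 →
      (∀ p ∈ c.tiles, w.grid p = true ∨ p - w.pos ∈ window M.radius) → I' c)
    (hc : Simulates M l c w) :
    Reach (M.toRobot l q₀).step I' l.length c
      { state := .inl (w.state, fun z => w.grid (w.pos + z), Fin.last _)
        pos := w.pos
        tiles := c.tiles } := by
  -- Induction on the number `k` of remaining moves; the memory is correct at the window pixels
  -- visited before index `i`. A pixel visited again yields the same bit.
  have key : ∀ k i : ℕ, (hk : i + k = l.length) → ∀ m : window M.radius → Bool,
      (∀ j < i, ∀ h : follow (l.take j) 0 ∈ window M.radius,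
        m ⟨_, h⟩ = w.grid (w.pos + follow (l.take j) 0)) →
      Reach (M.toRobot l q₀).step I' k
        { state := .inl (w.state, m, ⟨i, by omega⟩)
          pos := w.pos + follow (l.take i) 0
          tiles := c.tiles }
        { state := .inl (w.state, fun z => w.grid (w.pos + z), Fin.last _)
          pos := w.pos
          tiles := c.tiles } := by
    intro k
    induction k with
    | zero =>
      intro i hk m hm
      obtain rfl : i = l.length := by omega
      have : m = fun z : window M.radius => w.grid (w.pos + z) := by
        ext ⟨z, hz⟩
        obtain ⟨i, hi, rfl⟩ := hl z hz
        exact hm i hi hz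
      subst this
      rw [List.take_length, h0, add_zero]
      refine .refl (hI _ l.length ?_ fun p hp => .inl ((hc.tiles p).1 hp))
      simp [h0]
    | succ k ih =>
      intro i hk m hm
      have hi : i < l.length := by omega
      refine .cons (hI _ i rfl fun p hp => .inl ((hc.tiles p).1 hp)) ?_
        (ih (i + 1) (by omega) (fun z => if z.1 = follow (l.take i) 0 then
          w.grid (w.pos + follow (l.take i) 0) else m z) ?_)
      · simp only [Robot.step, toRobot, dif_pos hi, Option.map_some]
        have hb : decide (w.pos + follow (l.take i) 0 ∈ c.tiles) =
            w.grid (w.pos + follow (l.take i) 0) := by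
          rw [Bool.eq_iff_iff, decide_eq_true_iff, hc.tiles]
        congr 2
        · congr 3
          ext z
          rw [hb]
        · rw [Dir.move_add, follow_take_succ hi]
        · by_cases h : w.pos + follow (l.take i) 0 ∈ c.tiles
          · simp [h]
          · simp [h]
      · intro j hj h
        dsimp only
        split_ifs with he
        · rw [he]
        · refine hm j ?_ h
          rcases Nat.lt_succ_iff_lt_or_eq.1 hj with h | rfl
          · exact h
          · exact absurd rfl he
  obtain ⟨m, hm⟩ := hc.state
  have := key l.length 0 (by omega) m (by simp)
  convert this using 1
  cases c
  simp only [Config.mk.injEq] at *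
  exact ⟨hm, by simpa [follow] using hc.pos, trivial⟩

/-- The rewriting tour, after its first step has been decided upon. -/
theorem reach_write (h0 : follow l 0 = 0)
    (hl : ∀ z ∈ window M.radius, ∃ i < l.length, follow (l.take i) 0 = z)
    (hI : ∀ (c : Config (TourState Q M.radius l.length)) (i : ℕ),
      c.pos = w.pos + follow (l.take i) 0 →
      (∀ p ∈ c.tiles, w.grid p = true ∨ p - w.pos ∈ window M.radius) → I' c)
    (q : Q) (W : Pixel → Bool) (d : Dir)
    (hI'' : ∀ c, Simulates M l c ⟨q, d.move w.pos, overwrite M.radius w.pos W w.grid⟩ → I' c) :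
    ∀ k i : ℕ, (hk : i + k = l.length) → ∀ S : Finset Pixel,
      (∀ p, p ∈ S ↔ if p - w.pos ∈ window M.radius ∧ ∃ j < i, follow (l.take j) 0 = p - w.pos
        then W (p - w.pos) = true else w.grid p = true) →
      ∀ s, (M.toRobot l q₀).δ s (decide (w.pos + follow (l.take i) 0 ∈ S)) =
        some (M.writeAct l q (fun z => W z) d ⟨i, by omega⟩
          (decide (w.pos + follow (l.take i) 0 ∈ S))) →
      ∃ c', Simulates M l c' ⟨q, d.move w.pos, overwrite M.radius w.pos W w.grid⟩ ∧
        Reach (M.toRobot l q₀).step I' (k + 1) ⟨s, w.pos + follow (l.take i) 0, S⟩ c' := by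
  intro k
  have hS : ∀ i : ℕ, ∀ S : Finset Pixel, (∀ p, p ∈ S ↔ if p - w.pos ∈ window M.radius ∧
        ∃ j < i, follow (l.take j) 0 = p - w.pos
        then W (p - w.pos) = true else w.grid p = true) →
      ∀ p ∈ S, w.grid p = true ∨ p - w.pos ∈ window M.radius := by
    intro i S hS p hp
    rw [hS] at hp
    split_ifs at hp with h
    · exact .inr h.1
    · exact .inl hp
  -- One step extends the rewritten part from the indices below `i` to those below `i + 1`. Outside
  -- the window the robot writes back what it reads.
  have hwrite : ∀ i : ℕ, ∀ S : Finset Pixel,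
      (∀ p, p ∈ S ↔ if p - w.pos ∈ window M.radius ∧ ∃ j < i, follow (l.take j) 0 = p - w.pos
        then W (p - w.pos) = true else w.grid p = true) → ∀ p,
      (p ∈ (if (if h : follow (l.take i) 0 ∈ window M.radius then W (follow (l.take i) 0)
          else decide (w.pos + follow (l.take i) 0 ∈ S)) = true
        then insert (w.pos + follow (l.take i) 0) S
        else S.erase (w.pos + follow (l.take i) 0)) ↔
      if p - w.pos ∈ window M.radius ∧ ∃ j < i + 1, follow (l.take j) 0 = p - w.pos
        then W (p - w.pos) = true else w.grid p = true) := by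
    intro i S hS p
    have hmem : ∀ b : Bool, (p ∈ (if b = true then insert (w.pos + follow (l.take i) 0) S
        else S.erase (w.pos + follow (l.take i) 0)) ↔
        if p = w.pos + follow (l.take i) 0 then b = true else p ∈ S) := by
      intro b
      by_cases h : p = w.pos + follow (l.take i) 0 <;> cases b <;> simp [h]
    rw [hmem]
    have hex : (∃ j < i + 1, follow (l.take j) 0 = p - w.pos) ↔
        (∃ j < i, follow (l.take j) 0 = p - w.pos) ∨ follow (l.take i) 0 = p - w.pos := by
      constructor
      · rintro ⟨j, hj, he⟩
        rcases Nat.lt_succ_iff_lt_or_eq.1 hj with h | rfl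
        · exact .inl ⟨j, h, he⟩
        · exact .inr he
      · rintro (⟨j, hj, he⟩ | he)
        · exact ⟨j, by omega, he⟩
        · exact ⟨i, by omega, he⟩
    simp only [hex]
    by_cases hp : p = w.pos + follow (l.take i) 0
    · subst hp
      simp only [add_sub_cancel_left, or_true, and_true, if_true]
      by_cases hw : follow (l.take i) 0 ∈ window M.radius
      · simp [hw]
      · simp only [hw, if_false, dite_false, decide_eq_true_iff]
        rw [hS]
        simp [hw]
    · have : follow (l.take i) 0 ≠ p - w.pos := fun h => hp (by rw [h]; abel)
      simp only [hp, if_false, this, or_false]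
      exact hS p
  induction k with
  | zero =>
    intro i hk S hiS s hs
    obtain rfl : i = l.length := by omega
    have h0' : follow (l.take l.length) 0 = 0 := by rw [List.take_length, h0]
    refine ⟨?c, ?h1, .cons (hI _ l.length rfl (hS _ S hiS)) ?h2 (.refl (hI'' _ ?h1))⟩
    case h2 =>
      simp only [Robot.step]
      rw [hs]
      rfl
    case h1 =>
      refine ⟨⟨fun _ => false, ?_⟩, ?_, ?_⟩
      · simp [writeAct]
      · simp [writeAct, h0]
      · intro p
        have := hwrite l.length S hiS p
        simp only [writeAct]
        rw [dif_neg (by simp)]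
        refine Iff.trans this ?_
        have hin : (p - w.pos ∈ window M.radius ∧
            ∃ j < l.length + 1, follow (l.take j) 0 = p - w.pos) ↔
            p - w.pos ∈ window M.radius := by
          refine ⟨fun h => h.1, fun h => ⟨h, ?_⟩⟩
          obtain ⟨i, hi, he⟩ := hl _ h
          exact ⟨i, by omega, he⟩
        simp only [hin, overwrite]
        split_ifs <;> rfl
  | succ k ih =>
    intro i hk S hiS s hs
    have hi : i < l.length := by omega
    obtain ⟨c', hc', hr⟩ := ih (i + 1) (by omega) _ (hwrite i S hiS)
      (.inr (q, fun z => W z, d, ⟨i + 1, by omega⟩)) rfl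
    refine ⟨c', hc', .cons (hI _ i rfl (hS _ S hiS)) ?_ hr⟩
    simp only [Robot.step]
    rw [hs]
    simp only [writeAct, dif_pos hi, Option.map_some]
    rw [follow_take_succ hi, Dir.move_add]

end

theorem picture_view (K : ℤ) (a : Pixel) (g : Pixel → Bool) :
    picture (fun z : window K => g (a + z)) = view K a g := by
  ext z
  simp [picture, view]

/-- A window robot with finitely many states can be simulated by a robot with constant slowdown,
and at any time the two differ only near the position of the window robot. -/
theorem exists_robot [Finite Q] (M : WindowRobot Q) (q₀ : Q) :
    ∃ (Q' : Type) (_ : Finite Q') (R : Robot Q') (N : ℕ),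
      ∀ (I : World Q → Prop) (P : Finset Pixel) (s : Pixel) (n : ℕ) (w₀ w : World Q),
        w₀.state = q₀ → w₀.pos = s → (∀ p, w₀.grid p = true ↔ p ∈ P) →
        Reach M.step I n w₀ w → M.step w = none →
        ∃ T ≤ N * (n + 1), R.HaltedAt P s T ∧
          (∀ p, p ∈ (R.run P s T).tiles ↔ w.grid p = true) ∧
          ∀ t, ∃ w', I w' ∧ Near N (R.run P s t) w' := by
  obtain ⟨l, h0, hl⟩ := exists_tour (window M.radius)
  -- A simulated step takes `l.length` steps for reading and `l.length + 1` for rewriting, the last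
  -- of which makes the move of `M`. The radius is added so that the same constant also bounds the
  -- distance in `Near`.
  refine ⟨TourState Q M.radius l.length, inferInstance, M.toRobot l q₀,
    2 * l.length + 1 + M.radius.toNat, ?_⟩
  intro I P s n w₀ w hq hs hg hr hw
  set N : ℕ := 2 * l.length + 1 + M.radius.toNat with hN
  let I' : Config (TourState Q M.radius l.length) → Prop := fun c => ∃ w', I w' ∧ Near N c w'
  have hNK : M.radius ≤ N := by omega
  have hNl : (l.length : ℤ) ≤ N := by omega
  have hI : ∀ v : World Q, I v → ∀ (c : Config (TourState Q M.radius l.length)) (i : ℕ),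
      c.pos = v.pos + follow (l.take i) 0 →
      (∀ p ∈ c.tiles, v.grid p = true ∨ p - v.pos ∈ window M.radius) → I' c :=
    fun v hv c i h1 h2 => ⟨v, hv, near_of_follow hNK hNl h1 h2⟩
  have hSim : ∀ v : World Q, I v → ∀ c, Simulates M l c v → I' c := by
    intro v hv c hc
    exact hI v hv c 0 (by simpa [follow] using hc.pos) fun p hp => .inl ((hc.tiles p).1 hp)
  have key : ∃ c', Simulates M l c' w ∧ I w ∧
      Reach (M.toRobot l q₀).step I' (n * (2 * l.length + 1)) ((M.toRobot l q₀).run P s 0) c' := by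
    have : ∀ c, Simulates M l c w₀ → ∃ c', Simulates M l c' w ∧ I w ∧
        Reach (M.toRobot l q₀).step I' (n * (2 * l.length + 1)) c c' := by
      clear hq hs hg
      induction hr with
      | @refl v hv =>
        intro c hc
        exact ⟨c, hc, hv, by simpa using Reach.refl (hSim v hv c hc)⟩
      | @cons n v v' _ hv hst hr ih =>
        intro c hc
        have h1 := reach_read (q₀ := q₀) h0 hl (hI v hv) hc
        simp only [step, Option.map_eq_some_iff] at hst
        obtain ⟨⟨q, W, d⟩, hδ, rfl⟩ := hst
        obtain ⟨c1, hc1, h2⟩ := reach_write (q₀ := q₀) h0 hl (hI v hv) q W d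
          (hSim _ hr.left) l.length 0 (by omega) c.tiles (by simpa using hc.tiles)
          (.inl (v.state, fun z => v.grid (v.pos + z), Fin.last _)) (by
            simp only [toRobot, Fin.val_last, lt_irrefl, dite_false]
            rw [picture_view, hδ]
            simp [follow])
        obtain ⟨c', hc', hIw, h3⟩ := ih hw c1 hc1
        refine ⟨c', hc', hIw, ?_⟩
        have := (h1.trans (by simpa [follow] using h2)).trans h3
        convert this using 1
        ring
    refine this _ ⟨⟨fun _ => false, ?_⟩, ?_, ?_⟩
    · rw [hq]; rfl
    · exact hs.symm
    · exact fun p => (hg p).symm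
  obtain ⟨c', hc', hIw, hrun⟩ := key
  -- Termination of `M` is noticed only after one more reading tour.
  have hread := reach_read (q₀ := q₀) h0 hl (hI w hIw) hc'
  obtain ⟨h1, h2, h3⟩ := Robot.run_of_reach _ (hrun.trans hread) (by
    simp only [step, Option.map_eq_none_iff] at hw
    simp only [Robot.step, toRobot, Fin.val_last, lt_irrefl, dite_false]
    rw [picture_view, hw]
    rfl)
  refine ⟨_, ?_, h1, ?_, h3⟩
  · rw [hN]; nlinarith [Nat.zero_le M.radius.toNat, Nat.zero_le l.length, Nat.zero_le n,
      Nat.zero_le (M.radius.toNat * n)]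
  · rw [h2]; exact hc'.tiles

end WindowRobot

/-! ## Hiding a marker in a block of pixels -/

/-- No two by two square of the grid is coloured like a chessboard. -/
def ChessFree (p : Pixel → Bool) : Prop :=
  ∀ i j : ℤ, ¬ (p (i, j) = p (i + 1, j + 1) ∧ p (i + 1, j) = p (i, j + 1) ∧
    p (i, j) ≠ p (i + 1, j))

/-- A two by two square that is not coloured like a chessboard. -/
abbrev PlainSquare : Type :=
  {m : Bool × Bool → Bool // ¬ (m (false, false) = m (true, true) ∧
    m (true, false) = m (false, true) ∧ m (false, false) ≠ m (true, false))}

abbrev PlainBlock : Type := Fin 5 × Fin 5 → PlainSquare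

/-- The cells of a block that do not belong to its first two by two square. -/
abbrev FreeCell : Type := {z : Fin 10 × Fin 10 // ¬ ((z.1 : ℕ) < 2 ∧ (z.2 : ℕ) < 2)}

theorem card_plainSquare : Fintype.card PlainSquare = 14 := by decide +kernel

theorem card_freeCell : Fintype.card FreeCell = 96 := by decide +kernel

/-- This is `14 ^ 25 ≤ 2 ^ 96`. Ten is the least even side length that works: for eight, `14 ^ 16 >
2 ^ 60`. -/
theorem nonempty_plainBlock_embedding : Nonempty (PlainBlock ↪ (FreeCell → Bool)) := by
  apply Function.Embedding.nonempty_of_card_le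
  rw [Fintype.card_fun, Fintype.card_fun, card_plainSquare, card_freeCell]
  norm_num

noncomputable def plainBlockEmbedding : PlainBlock ↪ (FreeCell → Bool) :=
  nonempty_plainBlock_embedding.some

instance : Inhabited PlainSquare := ⟨⟨fun _ => false, by simp⟩⟩

def boolInt (b : Bool) : ℤ := if b then 1 else 0

-- A chessboard square goes to a default value; nothing is lost, because only chess-free contents
-- have to be recovered.
open Classical in
noncomputable def toPlainSquare (m : Bool × Bool → Bool) : PlainSquare :=
  if h : _ then ⟨m, h⟩ else default

noncomputable def toPlainBlock (c : Pixel → Bool) : PlainBlock := fun u =>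
  toPlainSquare fun b => c (2 * (u.1 : ℕ) + boolInt b.1, 2 * (u.2 : ℕ) + boolInt b.2)

/-- The content `c` of the block `[0, 10) × [0, 10)`, encoded together with the marker. -/
noncomputable def encode (c : Pixel → Bool) : Pixel → Bool := fun z =>
  if h : (0 ≤ z.1 ∧ z.1 < 10 ∧ 0 ≤ z.2 ∧ z.2 < 10) ∧ ¬ (z.1 < 2 ∧ z.2 < 2) then
    plainBlockEmbedding (toPlainBlock c)
      ⟨(⟨z.1.toNat, by omega⟩, ⟨z.2.toNat, by omega⟩), by simp; omega⟩
  else decide (z = (0, 1) ∨ z = (1, 0))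

noncomputable def decode (f : Pixel → Bool) : Pixel → Bool := fun z =>
  if h : 0 ≤ z.1 ∧ z.1 < 10 ∧ 0 ≤ z.2 ∧ z.2 < 10 then
    (Function.invFun plainBlockEmbedding fun y => f (((y.1.1 : ℕ) : ℤ), ((y.1.2 : ℕ) : ℤ)))
      (⟨z.1.toNat / 2, by omega⟩, ⟨z.2.toNat / 2, by omega⟩) |>.1
      (decide (z.1 % 2 = 1), decide (z.2 % 2 = 1))
  else false

theorem encode_marker (c : Pixel → Bool) : encode c (0, 0) = false ∧ encode c (1, 0) = true ∧
    encode c (0, 1) = true ∧ encode c (1, 1) = false := by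
  simp [encode]

/-- Allows the view of the robot to be replaced by the grid, with which it agrees on the block only.
-/
theorem encode_congr {c c' : Pixel → Bool}
    (h : ∀ a b : ℤ, 0 ≤ a → a < 10 → 0 ≤ b → b < 10 → c (a, b) = c' (a, b)) :
    encode c = encode c' := by
  have : toPlainBlock c = toPlainBlock c' := by
    funext u
    have : (fun b : Bool × Bool => c (2 * (u.1 : ℕ) + boolInt b.1, 2 * (u.2 : ℕ) + boolInt b.2)) =
        fun b => c' (2 * (u.1 : ℕ) + boolInt b.1, 2 * (u.2 : ℕ) + boolInt b.2) := by
      ext ⟨b1, b2⟩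
      have h1 := u.1.2
      have h2 := u.2.2
      apply h <;> cases b1 <;> cases b2 <;> simp only [boolInt] <;> simp <;> omega
    simp only [toPlainBlock, this]
  unfold encode
  rw [this]

theorem decode_congr {f f' : Pixel → Bool}
    (h : ∀ a b : ℤ, 0 ≤ a → a < 10 → 0 ≤ b → b < 10 → f (a, b) = f' (a, b)) :
    decode f = decode f' := by
  have : (fun y : FreeCell => f (((y.1.1 : ℕ) : ℤ), ((y.1.2 : ℕ) : ℤ))) =
      fun y => f' (((y.1.1 : ℕ) : ℤ), ((y.1.2 : ℕ) : ℤ)) := by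
    ext y
    have h1 := y.1.1.2
    have h2 := y.1.2.2
    apply h <;> omega
  unfold decode
  rw [this]

/-- The free cells carry the embedded plain block, and injectivity recovers it. Chess-freeness
ensures that every square passes `toPlainSquare` unchanged. -/
theorem decode_encode {c : Pixel → Bool} (hc : ChessFree c) {a b : ℤ} (ha : 0 ≤ a) (ha' : a < 10)
    (hb : 0 ≤ b) (hb' : b < 10) : decode (encode c) (a, b) = c (a, b) := by
  have : (fun y : FreeCell => encode c (((y.1.1 : ℕ) : ℤ), ((y.1.2 : ℕ) : ℤ))) =
      plainBlockEmbedding (toPlainBlock c) := by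
    ext ⟨⟨⟨y1, h1⟩, ⟨y2, h2⟩⟩, hy⟩
    simp only at hy
    simp only [encode]
    rw [dif_pos (by omega)]
    simp
  simp only [decode]
  rw [dif_pos ⟨ha, ha', hb, hb'⟩, this,
    Function.leftInverse_invFun plainBlockEmbedding.injective]
  simp only [toPlainBlock, toPlainSquare]
  rw [dif_pos]
  · simp only
    congr 1
    ext
    · simp only [boolInt]
      rcases Int.emod_two_eq_zero_or_one a with h | h <;> simp [h] <;> omega
    · simp only [boolInt]
      rcases Int.emod_two_eq_zero_or_one b with h | h <;> simp [h] <;> omega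
  · simpa [boolInt] using hc _ _

/-! ## Headings and local coordinates

A robot with a heading uses local coordinates: the first axis points forward, the second one to
its right-hand side. -/

/-- The linear map from local to absolute coordinates. -/
def Dir.rot : Dir → Pixel → Pixel
  | .up, z => (z.2, z.1)
  | .left, z => (-z.1, z.2)
  | .down, z => (-z.2, -z.1)
  | .right, z => (z.1, -z.2)

/-- The heading after a left turn. -/
def Dir.turn : Dir → Dir
  | .up => .left
  | .left => .down
  | .down => .right
  | .right => .up

inductive Act : Type
  | fwd | back | out

def Act.vec : Act → Pixel
  | .fwd => (1, 0)
  | .back => (-1, 0)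
  | .out => (0, 1)

def Act.dir : Act → Dir → Dir
  | .fwd, d => d
  | .back, .up => .down
  | .back, .left => .right
  | .back, .down => .up
  | .back, .right => .left
  | .out, .up => .right
  | .out, .left => .up
  | .out, .down => .left
  | .out, .right => .down

namespace Dir

theorem rot_add (d : Dir) (y z : Pixel) : d.rot (y + z) = d.rot y + d.rot z := by
  cases d <;> ext <;> simp [rot] <;> ring

theorem rot_sub (d : Dir) (y z : Pixel) : d.rot (y - z) = d.rot y - d.rot z := by
  cases d <;> ext <;> simp [rot] <;> ring

-- The axes "forward, right" are oriented oppositely to the absolute ones, so each `rot` is a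
-- reflection.
@[simp] theorem rot_rot (d : Dir) (z : Pixel) : d.rot (d.rot z) = z := by
  cases d <;> ext <;> simp [rot]

@[simp] theorem rot_zero (d : Dir) : d.rot 0 = 0 := by
  cases d <;> ext <;> simp [rot]

theorem rot_injective (d : Dir) : Function.Injective d.rot := fun y z h => by
  rw [← d.rot_rot y, h, rot_rot]

theorem rot_mem_window {d : Dir} {K : ℤ} {z : Pixel} : d.rot z ∈ window K ↔ z ∈ window K := by
  cases d <;> simp only [mem_window, rot] <;> omega

theorem rot_turn (d : Dir) (z : Pixel) : d.turn.rot z = d.rot (z.2, -z.1) := by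
  cases d <;> ext <;> simp [rot, turn]

theorem move_dir (d : Dir) (a : Act) (p : Pixel) : (a.dir d).move p = p + d.rot a.vec := by
  cases d <;> cases a <;> ext <;> simp [rot, Act.dir, Act.vec, move] <;> ring

end Dir

/-! ## The robot -/

inductive BotState : Type
  /-- Sets up the markers. -/
  | init
  /-- Follows a side of the rectangle; the side may grow if `k ≠ 1`. `prod` says whether a side
  has grown in the current phase of three sides, `flag` whether the lane contains a tile. -/
  | scan (k : Fin 3) (prod flag : Bool)
  /-- Returns to the start of the side after the marker at its end has been shifted. -/
  | back (k : Fin 3)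
  /-- Builds one side of the box, with `k` more sides to follow. -/
  | build (k : Fin 4) (e : Bool)
  | halt

instance : Finite BotState :=
  Finite.of_surjective (α := Option (Fin 3 × Bool × Bool ⊕ Fin 3 ⊕ Option (Fin 4 × Bool)))
    (fun x => match x with
      | none => .init
      | some (.inl (k, p, f)) => .scan k p f
      | some (.inr (.inl k)) => .back k
      | some (.inr (.inr (some (k, e)))) => .build k e
      | some (.inr (.inr none)) => .halt) fun y => by
    cases y with
    | init => exact ⟨none, rfl⟩
    | scan k p f => exact ⟨some (.inl (k, p, f)), rfl⟩
    | back k => exact ⟨some (.inr (.inl k)), rfl⟩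
    | build k e => exact ⟨some (.inr (.inr (some (k, e)))), rfl⟩
    | halt => exact ⟨some (.inr (.inr none)), rfl⟩

/-- The marker starts at the next pixel in direction `s` (forward or backward). -/
def markerAt (W : Pixel → Bool) (s : ℤ) : Bool :=
  !W (s, 0) && W (s, 1) && W (2 * s, 0) && !W (2 * s, 1)

/-- The window after the four markers around the current pixel have been set up. -/
noncomputable def setMarkers (W : Pixel → Bool) : Pixel → Bool := fun z =>
  if -10 ≤ z.1 ∧ z.1 ≤ -1 ∧ 1 ≤ z.2 ∧ z.2 ≤ 10 then
    encode (fun y => W (-1 - y.2, 1 + y.1)) (z.2 - 1, -1 - z.1)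
  else if 1 ≤ z.1 ∧ z.1 ≤ 10 ∧ 1 ≤ z.2 ∧ z.2 ≤ 10 then
    encode (fun y => W (1 + y.1, 1 + y.2)) (z.1 - 1, z.2 - 1)
  else if 1 ≤ z.1 ∧ z.1 ≤ 10 ∧ -10 ≤ z.2 ∧ z.2 ≤ -1 then
    encode (fun y => W (1 + y.2, -1 - y.1)) (-1 - z.2, z.1 - 1)
  else if -10 ≤ z.1 ∧ z.1 ≤ -1 ∧ -10 ≤ z.2 ∧ z.2 ≤ -1 then
    encode (fun y => W (-1 - y.1, -1 - y.2)) (-1 - z.1, -1 - z.2)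
  else W z

/-- The window without the marker ahead. -/
noncomputable def eraseAhead (W : Pixel → Bool) : Pixel → Bool := fun z =>
  if 1 ≤ z.1 ∧ z.1 ≤ 10 ∧ 0 ≤ z.2 ∧ z.2 ≤ 9 then
    decode (fun y => W (1 + y.1, y.2)) (z.1 - 1, z.2)
  else W z

/-- The window after the marker ahead has been shifted to the right. -/
noncomputable def shiftAhead (W : Pixel → Bool) : Pixel → Bool := fun z =>
  if 1 ≤ z.1 ∧ z.1 ≤ 10 ∧ 1 ≤ z.2 ∧ z.2 ≤ 10 then
    encode (fun y => eraseAhead W (1 + y.1, 1 + y.2)) (z.1 - 1, z.2 - 1)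
  else eraseAhead W z

/-- The window without the marker behind. -/
noncomputable def eraseBehind (W : Pixel → Bool) : Pixel → Bool := fun z =>
  if -10 ≤ z.1 ∧ z.1 ≤ -1 ∧ 0 ≤ z.2 ∧ z.2 ≤ 9 then
    decode (fun y => W (-1 - y.2, y.1)) (z.2, -1 - z.1)
  else W z

/-- The window after the marker behind has been shifted to the right. -/
noncomputable def shiftBehind (W : Pixel → Bool) : Pixel → Bool := fun z =>
  if -10 ≤ z.1 ∧ z.1 ≤ -1 ∧ 1 ≤ z.2 ∧ z.2 ≤ 10 then
    encode (fun y => eraseBehind W (-1 - y.2, 1 + y.1)) (z.2 - 1, -1 - z.1)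
  else eraseBehind W z

/-- The window with the next row of the box. -/
def buildRow (e : Bool) (W : Pixel → Bool) : Pixel → Bool := fun z =>
  if z.1 = 1 ∧ 1 ≤ z.2 ∧ z.2 ≤ 2 then xor e (decide (Odd (z.1 + z.2))) else W z

/-- The window with the marker ahead replaced by a corner of the box. -/
def buildCorner (e : Bool) (W : Pixel → Bool) : Pixel → Bool := fun z =>
  if 1 ≤ z.1 ∧ z.1 ≤ 10 ∧ 0 ≤ z.2 ∧ z.2 ≤ 9 then
    xor e (decide (Odd (z.1 + z.2))) &&
      decide (z.1 ≤ 3 ∧ z.2 ≤ 2 ∧ (2 ≤ z.1 ∨ 1 ≤ z.2) ∧ ¬ (z.1 = 3 ∧ z.2 = 2))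
  else W z

/-- The program in local coordinates: the new state and window, the move, and whether the robot
turns left after it. -/
noncomputable def rule : BotState → (Pixel → Bool) →
    Option (BotState × (Pixel → Bool) × Act × Bool)
  | .init, W => some (.scan 0 true (W (0, 1)), setMarkers W, .out, false)
  | .scan k prod flag, W =>
    if markerAt W 1 then
      if flag && decide (k ≠ 1) then some (.back k, shiftAhead W, .fwd, false)
      else if k = 0 then some (.scan 1 prod false, W, .fwd, true)
      else if k = 1 then some (.scan 2 prod false, W, .fwd, true)
      else if prod then some (.scan 0 false false, W, .fwd, true)
      else some (.build 3 true, W, .fwd, true)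
    else some (.scan k prod (flag || W (1, 0)), W, .fwd, false)
  | .back k, W =>
    if markerAt W (-1) then some (.scan k true (W (0, 1)), shiftBehind W, .out, false)
    else some (.back k, W, .back, false)
  | .build k e, W =>
    if markerAt W 1 then
      some (if k = 0 then .halt else .build (k - 1) (!e), buildCorner e W, .fwd, true)
    else some (.build k (!e), buildRow e W, .fwd, false)
  | .halt, _ => none

/-- The robot that constructs the bounding box. -/
noncomputable def bot : WindowRobot (BotState × Dir) where
  radius := 11
  δ s V := (rule s.1 (V ∘ s.2.rot)).map fun r =>
    ((r.1, if r.2.2.2 then s.2.turn else s.2), r.2.1 ∘ s.2.rot, r.2.2.1.dir s.2)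

/-- The configuration in which the robot is at `a` and the grid is `h` in the local coordinates
with origin `o` and heading `d`. -/
def localWorld (q : BotState) (o : Pixel) (d : Dir) (a : Pixel) (h : Pixel → Bool) :
    World (BotState × Dir) where
  state := (q, d)
  pos := o + d.rot a
  grid p := h (d.rot (p - o))

/-- The window is a square centred at the robot, hence invariant under `rot`. -/
theorem view_localWorld (o : Pixel) (d : Dir) (a : Pixel) (h : Pixel → Bool) :
    view 11 (o + d.rot a) (fun p => h (d.rot (p - o))) ∘ d.rot = view 11 a h := by
  ext z
  simp only [Function.comp, view, Dir.rot_mem_window]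
  rw [show o + d.rot a + d.rot z - o = d.rot a + d.rot z by abel, Dir.rot_add]
  simp

theorem overwrite_localWorld (o : Pixel) (d : Dir) (a : Pixel) (W h : Pixel → Bool) :
    overwrite 11 (o + d.rot a) (W ∘ d.rot) (fun p => h (d.rot (p - o))) =
      fun p => overwrite 11 a W h (d.rot (p - o)) := by
  ext p
  have h1 : d.rot (p - (o + d.rot a)) = d.rot (p - o) - a := by
    rw [← sub_sub, Dir.rot_sub, Dir.rot_rot]
  have h2 : p - (o + d.rot a) ∈ window 11 ↔ d.rot (p - o) - a ∈ window 11 := by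
    rw [← Dir.rot_mem_window (d := d), h1]
  simp only [overwrite, Function.comp, h1, h2]

/-- With this the program is analysed in local coordinates, uniformly for all headings. -/
theorem bot_step {q q' : BotState} {a : Pixel} {h W : Pixel → Bool} {act : Act}
    (hr : rule q (view 11 a h) = some (q', W, act, false)) (o : Pixel) (d : Dir) :
    bot.step (localWorld q o d a h) =
      some (localWorld q' o d (a + act.vec) (overwrite 11 a W h)) := by
  simp only [WindowRobot.step, bot, localWorld, view_localWorld, hr, Option.map_some,
    overwrite_localWorld, Dir.move_dir, Dir.rot_add, add_assoc]
  rfl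

/-- The change of local coordinates for a left turn at `a`. -/
def turnAt (a z : Pixel) : Pixel := (a.1 + z.2, a.2 - z.1)

theorem rot_turnAt (o : Pixel) (d : Dir) (a z : Pixel) :
    o + d.rot (turnAt a z) = o + d.rot a + d.turn.rot z := by
  rw [Dir.rot_turn, add_assoc, ← Dir.rot_add]
  rfl

theorem localWorld_turn (q : BotState) (o : Pixel) (d : Dir) (a : Pixel) (h : Pixel → Bool) :
    ({ state := (q, d.turn), pos := o + d.rot a, grid := fun p => h (d.rot (p - o)) } :
      World (BotState × Dir)) = localWorld q (o + d.rot a) d.turn 0 (h ∘ turnAt a) := by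
  simp only [localWorld, Dir.rot_zero, add_zero, World.mk.injEq, true_and]
  ext p
  simp only [Function.comp]
  congr 1
  apply d.rot_injective
  apply add_left_cancel (a := o)
  rw [rot_turnAt]
  simp

theorem bot_step_turn {q q' : BotState} {a : Pixel} {h W : Pixel → Bool} {act : Act}
    (hr : rule q (view 11 a h) = some (q', W, act, true)) (o : Pixel) (d : Dir) :
    bot.step (localWorld q o d a h) = some (localWorld q' (o + d.rot (a + act.vec)) d.turn 0
      (overwrite 11 a W h ∘ turnAt (a + act.vec))) := by
  rw [← localWorld_turn]
  simp only [WindowRobot.step, bot, localWorld, view_localWorld, hr, Option.map_some,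
    overwrite_localWorld, Dir.move_dir, Dir.rot_add, add_assoc]
  rfl

theorem bot_step_halt (o : Pixel) (d : Dir) (a : Pixel) (h : Pixel → Bool) :
    bot.step (localWorld .halt o d a h) = none := by
  simp [WindowRobot.step, bot, localWorld, rule]

theorem overwrite_view (K : ℤ) (a : Pixel) (h : Pixel → Bool) :
    overwrite K a (view K a h) h = h := by
  ext p
  simp only [overwrite, view]
  split_ifs <;> simp

/-- Changes of coordinates by translation. -/
theorem localWorld_translate (q : BotState) (o : Pixel) (d : Dir) (a b : Pixel)
    (h : Pixel → Bool) :
    localWorld q o d (b + a) h = localWorld q (o + d.rot b) d a (fun z => h (b + z)) := by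
  simp only [localWorld, World.mk.injEq, true_and, Dir.rot_add, add_assoc]
  ext p
  congr 1
  rw [← sub_sub, Dir.rot_sub d (p - o), Dir.rot_rot]
  abel

/-! ## Marked rectangles -/

/-- In local coordinates, `h` arises from `p` by marking the corners of the rectangle
`[1, L] × [-H, -1]`. The markers at the two front corners are shifted outwards by `s` and `t`. -/
structure Marked (p h : Pixel → Bool) (L H s t : ℤ) : Prop where
  start : ∀ a b : ℤ, 0 ≤ a → a < 10 → 0 ≤ b → b < 10 →
    h (-b, s + a) = encode (fun y => p (-y.2, s + y.1)) (a, b)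
  finish : ∀ a b : ℤ, 0 ≤ a → a < 10 → 0 ≤ b → b < 10 →
    h (L + 1 + a, t + b) = encode (fun y => p (L + 1 + y.1, t + y.2)) (a, b)
  finishOpp : ∀ a b : ℤ, 0 ≤ a → a < 10 → 0 ≤ b → b < 10 →
    h (L + 1 + b, -H - 1 - a) = encode (fun y => p (L + 1 + y.2, -H - 1 - y.1)) (a, b)
  startOpp : ∀ a b : ℤ, 0 ≤ a → a < 10 → 0 ≤ b → b < 10 →
    h (-a, -H - 1 - b) = encode (fun y => p (-y.1, -H - 1 - y.2)) (a, b)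
  rest : ∀ i j : ℤ, ¬ (-10 < i ∧ i ≤ 0 ∧ s ≤ j ∧ j < s + 10) →
    ¬ (L + 1 ≤ i ∧ i < L + 11 ∧ t ≤ j ∧ j < t + 10) →
    ¬ (L + 1 ≤ i ∧ i < L + 11 ∧ -H - 11 < j ∧ j ≤ -H - 1) →
    ¬ (-10 < i ∧ i ≤ 0 ∧ -H - 11 < j ∧ j ≤ -H - 1) → h (i, j) = p (i, j)

theorem view_apply {a z : Pixel} {h : Pixel → Bool} {K : ℤ} (hz : z ∈ window K) :
    view K a h z = h (a + z) := if_pos hz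

theorem view_pair {i j x y : ℤ} {h : Pixel → Bool} (h1 : -11 ≤ x) (h2 : x ≤ 11) (h3 : -11 ≤ y)
    (h4 : y ≤ 11) : view 11 (i, j) h (x, y) = h (i + x, j + y) :=
  view_apply (mem_window.2 ⟨h1, h2, h3, h4⟩)

theorem overwrite_pair {i j x y : ℤ} {W h : Pixel → Bool} (h1 : -11 ≤ x) (h2 : x ≤ 11)
    (h3 : -11 ≤ y) (h4 : y ≤ 11) : overwrite 11 (i, j) W h (i + x, j + y) = W (x, y) := by
  have : ((i + x, j + y) : Pixel) - (i, j) = (x, y) := by ext <;> simp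
  rw [overwrite, this, if_pos (mem_window.2 ⟨h1, h2, h3, h4⟩)]

/-- Where the window is not changed, neither is the grid. -/
theorem overwrite_of_eq_view {i j x y : ℤ} {W h : Pixel → Bool}
    (hW : W (x, y) = view 11 (i, j) h (x, y)) :
    overwrite 11 (i, j) W h (i + x, j + y) = h (i + x, j + y) := by
  have : ((i + x, j + y) : Pixel) - (i, j) = (x, y) := by ext <;> simp
  rw [overwrite, this]
  split_ifs with hz
  · rw [hW, view_apply hz]; rfl
  · rfl

/-- Translations, reflections in the axes and their exchange permute the two by two squares and
preserve diagonals. The marker blocks are read in such different orientations. -/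
theorem ChessFree.transpose {p : Pixel → Bool} (hp : ChessFree p) {f : Pixel → Pixel} (u v : ℤ)
    (su sv : ℤ) (hu : su = 1 ∨ su = -1) (hv : sv = 1 ∨ sv = -1)
    (hf : (∀ z, f z = (u + su * z.1, v + sv * z.2)) ∨ ∀ z, f z = (u + su * z.2, v + sv * z.1)) :
    ChessFree fun z => p (f z) := by
  rintro i j ⟨h1, h2, h3⟩
  rcases hf with hf | hf <;> simp only [hf] at h1 h2 h3 <;>
  rcases hu with rfl | rfl <;> rcases hv with rfl | rfl <;> ring_nf at h1 h2 h3
  · have := hp (u + i) (v + j)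
    ring_nf at this
    simp_all
  · have := hp (u + i) (v - j - 1)
    ring_nf at this
    simp_all
  · have := hp (u - i - 1) (v + j)
    ring_nf at this
    simp_all
  · have := hp (u - i - 1) (v - j - 1)
    ring_nf at this
    simp_all
  · have := hp (u + j) (v + i)
    ring_nf at this
    simp_all
  · have := hp (u + j) (v - i - 1)
    ring_nf at this
    simp_all
  · have := hp (u - j - 1) (v + i)
    ring_nf at this
    simp_all
  · have := hp (u - j - 1) (v - i - 1)
    ring_nf at this
    simp_all

/-! ### Turning, enlarging and creating marked rectangles -/

namespace Marked

variable {p h : Pixel → Bool} {L H s t : ℤ}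

theorem finish_marker (hm : Marked p h L H s t) : h (L + 1, t) = false ∧ h (L + 2, t) = true ∧
    h (L + 1, t + 1) = true ∧ h (L + 2, t + 1) = false := by
  have h1 := hm.finish 0 0
  have h2 := hm.finish 1 0
  have h3 := hm.finish 0 1
  have h4 := hm.finish 1 1
  simp only [encode_marker] at h1 h2 h3 h4
  norm_num [add_assoc] at h1 h2 h3 h4
  exact ⟨h1, h2, h3, h4⟩

theorem start_marker (hm : Marked p h L H s t) : h (0, s) = false ∧ h (-1, s) = true ∧
    h (0, s + 1) = true ∧ h (-1, s + 1) = false := by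
  have h1 := hm.start 0 0
  have h2 := hm.start 1 0
  have h3 := hm.start 0 1
  have h4 := hm.start 1 1
  simp only [encode_marker] at h1 h2 h3 h4
  norm_num at h1 h2 h3 h4
  exact ⟨h1, h3, h2, h4⟩

/-- Above a side, the grid is unchanged. -/
theorem lane (hm : Marked p h L H s t) {i j : ℤ} (h1 : 1 ≤ i) (h2 : i ≤ L) :
    h (i, j) = p (i, j) := hm.rest i j (by omega) (by omega) (by omega) (by omega)

/-- The orientations of the four blocks are chosen such that a quarter turn carries each of them to
the next; the fields are permuted cyclically. -/
theorem turn (hm : Marked p h L H 0 0) :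
    Marked (p ∘ turnAt (L + 1, 0)) (h ∘ turnAt (L + 1, 0)) H L 0 0 := by
  constructor
  · intro a b h1 h2 h3 h4
    have := hm.finish a b h1 h2 h3 h4
    simpa [turnAt] using this
  · intro a b h1 h2 h3 h4
    have := hm.finishOpp a b h1 h2 h3 h4
    simp only [turnAt, Function.comp, zero_add, zero_sub]
    convert this using 2
    · ext <;> simp; ring
    · funext y; congr 2; ring
  · intro a b h1 h2 h3 h4
    have := hm.startOpp a b h1 h2 h3 h4
    simp only [turnAt, Function.comp, zero_sub]
    convert this using 2
    · ext <;> simp <;> ring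
    · funext y; congr 2 <;> ring
  · intro a b h1 h2 h3 h4
    have := hm.start a b h1 h2 h3 h4
    simp only [turnAt, Function.comp, zero_sub]
    convert this using 2
    · ext <;> simp; ring
    · funext y; congr 2 <;> ring
  · intro i j h1 h2 h3 h4
    exact hm.rest _ _ (by simp; omega) (by simp; omega) (by simp; omega) (by simp; omega)

/-- Once both front markers are shifted, the same grid marks a rectangle with one more row; the
translation moves its front lane back to second coordinate zero. -/
theorem grow (hm : Marked p h L H 1 1) :
    Marked (fun z => p ((0, 1) + z)) (fun z => h ((0, 1) + z)) L (H + 1) 0 0 := by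
  constructor
  · intro a b h1 h2 h3 h4
    simpa using hm.start a b h1 h2 h3 h4
  · intro a b h1 h2 h3 h4
    simpa using hm.finish a b h1 h2 h3 h4
  · intro a b h1 h2 h3 h4
    have := hm.finishOpp a b h1 h2 h3 h4
    convert this using 2
    · ext <;> simp; ring
    · funext y; congr 1; ext <;> simp; ring
  · intro a b h1 h2 h3 h4
    have := hm.startOpp a b h1 h2 h3 h4
    convert this using 2
    · ext <;> simp; ring
    · funext y; congr 1; ext <;> simp; ring
  · intro i j h1 h2 h3 h4
    simpa using hm.rest i (1 + j) (by omega) (by omega) (by omega) (by omega)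

/-- The old and the new block overlap, so the old one is decoded first; the new one then encodes `p`
and not the marked grid. -/
theorem shiftAhead (hm : Marked p h L H 0 0) (hp : ChessFree p) (hL : 1 ≤ L) (hH : 1 ≤ H) :
    Marked p (overwrite 11 (L, 0) (shiftAhead (view 11 (L, 0) h)) h) L H 0 1 := by
  set W := view 11 (L, 0) h with hW
  -- After erasing, the window shows `p` on the union of both blocks.
  have herase : ∀ x y, 1 ≤ x → x ≤ 10 → 0 ≤ y → y ≤ 10 → eraseAhead W (x, y) = p (L + x, y) := by
    intro x y h1 h2 h3 h4
    simp only [eraseAhead]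
    split_ifs with hc
    · have : decode (fun y => W (1 + y.1, y.2)) =
          decode (encode (fun y => p (L + 1 + y.1, 0 + y.2))) := by
        apply decode_congr
        intro a b ha ha' hb hb'
        rw [← hm.finish a b ha ha' hb hb', hW, view_pair (by omega) (by omega) (by omega)
          (by omega), add_assoc]
      rw [this, decode_encode _ (by omega) (by omega) (by omega) (by omega)]
      · congr 2 <;> ring
      · exact hp.transpose (L + 1) 0 1 1 (by simp) (by simp) (.inl fun z => by simp)
    · rw [hW, view_pair (by omega) (by omega) (by omega) (by omega), zero_add]
      exact hm.rest _ _ (by omega) (by omega) (by omega) (by omega)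
  have hsame : ∀ i j, ¬ (L + 1 ≤ i ∧ i ≤ L + 10 ∧ 0 ≤ j ∧ j ≤ 10) →
      overwrite 11 (L, 0) (_root_.shiftAhead W) h (i, j) = h (i, j) := by
    intro i j hij
    have := overwrite_of_eq_view (i := L) (j := 0) (x := i - L) (y := j) (h := h)
      (W := _root_.shiftAhead W) (by
        simp only [_root_.shiftAhead, eraseAhead]
        rw [if_neg (by omega), if_neg (by omega)])
    simpa using this
  constructor
  · intro a b h1 h2 h3 h4
    rw [hsame _ _ (by omega)]
    exact hm.start a b h1 h2 h3 h4
  · intro a b h1 h2 h3 h4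
    have := overwrite_pair (i := L) (j := 0) (x := 1 + a) (y := 1 + b) (h := h)
      (W := _root_.shiftAhead W) (by omega) (by omega) (by omega) (by omega)
    rw [show ((L + 1 + a, 1 + b) : Pixel) = (L + (1 + a), 0 + (1 + b)) by
      ext <;> simp; ring, this]
    simp only [_root_.shiftAhead]
    rw [if_pos (by omega)]
    have : encode (fun y => eraseAhead W (1 + y.1, 1 + y.2)) =
        encode (fun y => p (L + 1 + y.1, 1 + y.2)) := by
      apply encode_congr
      intro a b ha ha' hb hb'
      simp only
      rw [herase _ _ (by omega) (by omega) (by omega) (by omega), add_assoc]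
    rw [this]
    congr 2 <;> ring
  · intro a b h1 h2 h3 h4
    rw [hsame _ _ (by omega)]
    exact hm.finishOpp a b h1 h2 h3 h4
  · intro a b h1 h2 h3 h4
    rw [hsame _ _ (by omega)]
    exact hm.startOpp a b h1 h2 h3 h4
  · intro i j h1 h2 h3 h4
    by_cases hij : L + 1 ≤ i ∧ i ≤ L + 10 ∧ 0 ≤ j ∧ j ≤ 10
    · have := overwrite_pair (i := L) (j := 0) (x := i - L) (y := j) (h := h)
        (W := _root_.shiftAhead W) (by omega) (by omega) (by omega) (by omega)
      rw [show ((i, j) : Pixel) = (L + (i - L), 0 + j) by ext <;> simp, this]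
      simp only [_root_.shiftAhead]
      rw [if_neg (by omega), herase _ _ (by omega) (by omega) (by omega) (by omega)]
      simp
    · rw [hsame _ _ hij]
      exact hm.rest i j h1 (by omega) h3 h4

theorem shiftBehind (hm : Marked p h L H 0 1) (hp : ChessFree p) (hL : 1 ≤ L) (hH : 1 ≤ H) :
    Marked p (overwrite 11 (1, 0) (shiftBehind (view 11 (1, 0) h)) h) L H 1 1 := by
  set W := view 11 (1, 0) h with hW
  have herase : ∀ x y, -10 ≤ x → x ≤ -1 → 0 ≤ y → y ≤ 10 →
      eraseBehind W (x, y) = p (1 + x, y) := by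
    intro x y h1 h2 h3 h4
    simp only [eraseBehind]
    split_ifs with hc
    · have : decode (fun y => W (-1 - y.2, y.1)) =
          decode (encode (fun y => p (-y.2, 0 + y.1))) := by
        apply decode_congr
        intro a b ha ha' hb hb'
        rw [← hm.start a b ha ha' hb hb', hW, view_pair (by omega) (by omega) (by omega)
          (by omega)]
        congr 2; ring
      rw [this, decode_encode _ (by omega) (by omega) (by omega) (by omega)]
      · congr 2 <;> ring
      · exact hp.transpose 0 0 (-1) 1 (by simp) (by simp) (.inr fun z => by simp)
    · rw [hW, view_pair (by omega) (by omega) (by omega) (by omega), zero_add]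
      exact hm.rest _ _ (by omega) (by omega) (by omega) (by omega)
  have hsame : ∀ i j, ¬ (-9 ≤ i ∧ i ≤ 0 ∧ 0 ≤ j ∧ j ≤ 10) →
      overwrite 11 (1, 0) (_root_.shiftBehind W) h (i, j) = h (i, j) := by
    intro i j hij
    have := overwrite_of_eq_view (i := 1) (j := 0) (x := i - 1) (y := j) (h := h)
      (W := _root_.shiftBehind W) (by
        simp only [_root_.shiftBehind, eraseBehind]
        rw [if_neg (by omega), if_neg (by omega)])
    simpa using this
  constructor
  · intro a b h1 h2 h3 h4
    have := overwrite_pair (i := 1) (j := 0) (x := -1 - b) (y := 1 + a) (h := h)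
      (W := _root_.shiftBehind W) (by omega) (by omega) (by omega) (by omega)
    rw [show ((-b, 1 + a) : Pixel) = (1 + (-1 - b), 0 + (1 + a)) by
      ext <;> simp; ring, this]
    simp only [_root_.shiftBehind]
    rw [if_pos (by omega)]
    have : encode (fun y => eraseBehind W (-1 - y.2, 1 + y.1)) =
        encode (fun y => p (-y.2, 1 + y.1)) := by
      apply encode_congr
      intro a b ha ha' hb hb'
      simp only
      rw [herase _ _ (by omega) (by omega) (by omega) (by omega)]
      congr 2; ring
    rw [this]
    congr 2 <;> ring
  · intro a b h1 h2 h3 h4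
    rw [hsame _ _ (by omega)]
    exact hm.finish a b h1 h2 h3 h4
  · intro a b h1 h2 h3 h4
    rw [hsame _ _ (by omega)]
    exact hm.finishOpp a b h1 h2 h3 h4
  · intro a b h1 h2 h3 h4
    rw [hsame _ _ (by omega)]
    exact hm.startOpp a b h1 h2 h3 h4
  · intro i j h1 h2 h3 h4
    by_cases hij : -9 ≤ i ∧ i ≤ 0 ∧ 0 ≤ j ∧ j ≤ 10
    · have := overwrite_pair (i := 1) (j := 0) (x := i - 1) (y := j) (h := h)
        (W := _root_.shiftBehind W) (by omega) (by omega) (by omega) (by omega)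
      rw [show ((i, j) : Pixel) = (1 + (i - 1), 0 + j) by ext <;> simp, this]
      simp only [_root_.shiftBehind]
      rw [if_neg (by omega), herase _ _ (by omega) (by omega) (by omega) (by omega)]
      simp
    · rw [hsame _ _ hij]
      exact hm.rest i j (by omega) h2 h3 h4

/-- The initial rectangle is the robot's own pixel `(1, -1)`; the four blocks touch it at its
corners. -/
theorem setMarkers (p : Pixel → Bool) : Marked p
    (overwrite 11 (1, -1) (setMarkers (view 11 (1, -1) p)) p) 1 1 0 0 := by
  set W := view 11 (1, -1) p with hW
  have hcell : ∀ i j, -10 ≤ i → i ≤ 12 → -12 ≤ j → j ≤ 10 →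
      overwrite 11 (1, -1) (_root_.setMarkers W) p (i, j) = _root_.setMarkers W (i - 1, j + 1) := by
    intro i j h1 h2 h3 h4
    rw [← overwrite_pair (i := 1) (j := -1) (x := i - 1) (y := j + 1) (h := p)
      (W := _root_.setMarkers W) (by omega) (by omega) (by omega) (by omega)]
    congr 2 <;> ring
  have hWp : ∀ x y, -11 ≤ x → x ≤ 11 → -11 ≤ y → y ≤ 11 → W (x, y) = p (1 + x, -1 + y) :=
    fun x y h1 h2 h3 h4 => view_pair h1 h2 h3 h4
  constructor
  · intro a b h1 h2 h3 h4
    rw [hcell _ _ (by omega) (by omega) (by omega) (by omega)]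
    simp only [_root_.setMarkers]
    rw [if_pos (by omega)]
    have := encode_congr (c := fun y => W (-1 - y.2, 1 + y.1))
      (c' := fun y => p (-y.2, 0 + y.1)) fun a b ha ha' hb hb' => by
        simp only
        rw [hWp _ _ (by omega) (by omega) (by omega) (by omega)]
        congr 2 <;> ring
    rw [this]
    congr 2 <;> ring
  · intro a b h1 h2 h3 h4
    rw [hcell _ _ (by omega) (by omega) (by omega) (by omega)]
    simp only [_root_.setMarkers]
    rw [if_neg (by omega), if_pos (by omega)]
    have := encode_congr (c := fun y => W (1 + y.1, 1 + y.2))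
      (c' := fun y => p (1 + 1 + y.1, 0 + y.2)) fun a b ha ha' hb hb' => by
        simp only
        rw [hWp _ _ (by omega) (by omega) (by omega) (by omega)]
        congr 2 <;> ring
    rw [this]
    congr 2 <;> ring
  · intro a b h1 h2 h3 h4
    rw [hcell _ _ (by omega) (by omega) (by omega) (by omega)]
    simp only [_root_.setMarkers]
    rw [if_neg (by omega), if_neg (by omega), if_pos (by omega)]
    have := encode_congr (c := fun y => W (1 + y.2, -1 - y.1))
      (c' := fun y => p (1 + 1 + y.2, -1 - 1 - y.1)) fun a b ha ha' hb hb' => by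
        simp only
        rw [hWp _ _ (by omega) (by omega) (by omega) (by omega)]
        congr 2 <;> ring
    rw [this]
    congr 2 <;> ring
  · intro a b h1 h2 h3 h4
    rw [hcell _ _ (by omega) (by omega) (by omega) (by omega)]
    simp only [_root_.setMarkers]
    rw [if_neg (by omega), if_neg (by omega), if_neg (by omega), if_pos (by omega)]
    have := encode_congr (c := fun y => W (-1 - y.1, -1 - y.2))
      (c' := fun y => p (-y.1, -1 - 1 - y.2)) fun a b ha ha' hb hb' => by
        simp only
        rw [hWp _ _ (by omega) (by omega) (by omega) (by omega)]
        congr 2 <;> ring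
    rw [this]
    congr 2 <;> ring
  · intro i j h1 h2 h3 h4
    have := overwrite_of_eq_view (i := 1) (j := -1) (x := i - 1) (y := j + 1) (h := p)
      (W := _root_.setMarkers W) (by
        simp only [_root_.setMarkers]
        rw [if_neg (by omega), if_neg (by omega), if_neg (by omega), if_neg (by omega)])
    rw [show ((i, j) : Pixel) = (1 + (i - 1), -1 + (j + 1)) by ext <;> simp]
    exact this

end Marked

/-! ## The polyomino in local coordinates -/

/-- The tiles of `P` in the local coordinates with origin `o` and heading `d`. -/
def localTiles (P : Finset Pixel) (o : Pixel) (d : Dir) : Pixel → Bool :=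
  fun z => decide (o + d.rot z ∈ P)

theorem localTiles_turn (P : Finset Pixel) (o : Pixel) (d : Dir) (a : Pixel) :
    localTiles P (o + d.rot a) d.turn = localTiles P o d ∘ turnAt a := by
  ext z
  simp only [localTiles, Function.comp, rot_turnAt]

theorem localTiles_translate (P : Finset Pixel) (o : Pixel) (d : Dir) (b : Pixel) :
    localTiles P (o + d.rot b) d = fun z => localTiles P o d (b + z) := by
  ext z
  simp only [localTiles, Dir.rot_add, add_assoc]

theorem gridGraph_adj {p q : Pixel} : gridGraph.Adj p q ↔ |p.1 - q.1| + |p.2 - q.2| = 1 := Iff.rfl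

theorem gridGraph_adj_rot {o : Pixel} {d : Dir} {y z : Pixel} :
    gridGraph.Adj (o + d.rot y) (o + d.rot z) ↔ gridGraph.Adj y z := by
  simp only [gridGraph_adj, abs_eq_max_neg]
  cases d <;> simp only [Dir.rot, Prod.fst_add, Prod.snd_add] <;> omega

theorem isDiagonalPair_rot {o : Pixel} {d : Dir} {y z : Pixel} :
    IsDiagonalPair (o + d.rot y) (o + d.rot z) ↔ IsDiagonalPair y z := by
  simp only [IsDiagonalPair, abs_eq_max_neg]
  cases d <;> simp only [Dir.rot, Prod.fst_add, Prod.snd_add] <;> omega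

theorem exists_local (o : Pixel) (d : Dir) (q : Pixel) : ∃ z, q = o + d.rot z :=
  ⟨d.rot (q - o), by simp⟩

theorem localTiles_diagonal {P : Finset Pixel} (hP : IsPolyomino P) (o : Pixel) (d : Dir)
    {y z : Pixel} (hy : localTiles P o d y = true) (hz : localTiles P o d z = true)
    (hyz : IsDiagonalPair y z) :
    localTiles P o d (y.1, z.2) = true ∨ localTiles P o d (z.1, y.2) = true := by
  simp only [localTiles, decide_eq_true_iff] at *
  obtain ⟨r, hr, h1, h2⟩ := hP.diagonal _ hy _ hz (isDiagonalPair_rot.2 hyz)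
  obtain ⟨x, rfl⟩ := exists_local o d r
  rw [gridGraph_adj_rot, gridGraph_adj] at h1 h2
  simp only [IsDiagonalPair] at hyz
  have : x = (y.1, z.2) ∨ x = (z.1, y.2) := by
    simp only [Prod.ext_iff]
    simp only [abs_eq_max_neg] at h1 h2 hyz
    omega
  rcases this with rfl | rfl
  · exact .inl hr
  · exact .inr hr

/-- The two tiles of a chessboard square would be a diagonal pair whose only common neighbours are
the two empty pixels of the square. -/
theorem localTiles_chessFree {P : Finset Pixel} (hP : IsPolyomino P) (o : Pixel) (d : Dir) :
    ChessFree (localTiles P o d) := by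
  rintro i j ⟨h1, h2, h3⟩
  cases hb : localTiles P o d (i, j) with
  | true =>
    have h4 : localTiles P o d (i + 1, j) = false := by simpa [hb] using h3
    have := localTiles_diagonal hP o d hb (h1 ▸ hb) (by simp [IsDiagonalPair])
    simp only [← h2, h4] at this
    simp at this
  | false =>
    have h4 : localTiles P o d (i + 1, j) = true := by simpa [hb] using h3
    have := localTiles_diagonal hP o d h4 (h2 ▸ h4) (by simp [IsDiagonalPair])
    simp only [← h1, hb] at this
    simp at this

theorem mem_rect_zero {P : Finset Pixel} {p : Pixel} (hp : p ∈ P) : p ∈ rect P 0 := by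
  have h1 : ((Prod.fst '' (P : Set Pixel)) : Set ℤ).Finite := P.finite_toSet.image _
  have h2 : ((Prod.snd '' (P : Set Pixel)) : Set ℤ).Finite := P.finite_toSet.image _
  have h3 : p.1 ∈ Prod.fst '' (P : Set Pixel) := ⟨p, hp, rfl⟩
  have h4 : p.2 ∈ Prod.snd '' (P : Set Pixel) := ⟨p, hp, rfl⟩
  simp only [rect, Set.mem_ofPred_eq, sub_zero, add_zero]
  exact ⟨csInf_le h1.bddBelow h3, le_csSup h1.bddAbove h3, csInf_le h2.bddBelow h4,
    le_csSup h2.bddAbove h4⟩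

theorem rect_mix {P : Finset Pixel} {k : ℤ} {o : Pixel} {d : Dir} {y z : Pixel}
    (hy : o + d.rot y ∈ rect P k) (hz : o + d.rot z ∈ rect P k) :
    o + d.rot (y.1, z.2) ∈ rect P k := by
  cases d <;> simp only [rect, Dir.rot, Set.mem_ofPred_eq, Prod.fst_add, Prod.snd_add] at * <;>
  omega

theorem rect_near {P : Finset Pixel} {k m : ℤ} {o : Pixel} {d : Dir} {y z : Pixel}
    (hy : o + d.rot y ∈ rect P k) (h1 : |y.1 - z.1| ≤ m) (h2 : |y.2 - z.2| ≤ m) :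
    o + d.rot z ∈ rect P (k + m) := by
  rw [abs_le] at h1 h2
  cases d <;> simp only [rect, Dir.rot, Set.mem_ofPred_eq, Prod.fst_add, Prod.snd_add] at * <;>
  omega

/-- The number of rows or columns of `P` in direction `d`. -/
noncomputable def Dir.span (d : Dir) (P : Finset Pixel) : ℕ :=
  match d with
  | .up | .down => height P
  | .left | .right => width P

theorem Dir.span_turn_turn (d : Dir) (P : Finset Pixel) : d.turn.turn.span P = d.span P := by
  cases d <;> rfl

/-- The local rectangle `[1, L] × [-H, -1]` lies in the bounding rectangle and contains a tile. -/
structure Inside (P : Finset Pixel) (o : Pixel) (d : Dir) (L H : ℕ) : Prop where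
  hL : 1 ≤ L
  hH : 1 ≤ H
  sub : ∀ i j : ℤ, 1 ≤ i → i ≤ L → -H ≤ j → j ≤ -1 → o + d.rot (i, j) ∈ rect P 0
  tile : ∃ i j : ℤ, 1 ≤ i ∧ i ≤ L ∧ -H ≤ j ∧ j ≤ -1 ∧ localTiles P o d (i, j) = true

namespace Inside

variable {P : Finset Pixel} {o : Pixel} {d : Dir} {L H : ℕ}

theorem le_span (hs : Inside P o d L H) : L ≤ d.span P ∧ H ≤ d.turn.span P := by
  obtain ⟨hL, hH, hs, -⟩ := hs
  have h1 := hs 1 (-1) (by omega) (by omega) (by omega) (by omega)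
  have h2 := hs L (-H) (by omega) (by omega) (by omega) (by omega)
  cases d <;> simp only [Dir.span, Dir.turn, rect, Dir.rot, Set.mem_ofPred_eq, Prod.fst_add,
    Prod.snd_add, width, height] at * <;> omega

theorem turn (hs : Inside P o d L H) : Inside P (o + d.rot (L + 1, 0)) d.turn H L := by
  refine ⟨hs.hH, hs.hL, fun i j h1 h2 h3 h4 => ?_, ?_⟩
  · rw [← rot_turnAt]
    exact hs.sub _ _ (by simp; omega) (by simp; omega) (by simp; omega) (by simp; omega)
  · obtain ⟨i, j, h1, h2, h3, h4, h5⟩ := hs.tile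
    refine ⟨-j, i - L - 1, by omega, by omega, by omega, by omega, ?_⟩
    rw [localTiles_turn]
    simpa [turnAt, sub_sub] using h5

theorem grow (hs : Inside P o d L H) {i : ℤ}
    (hi : localTiles P o d (i, 0) = true) : Inside P (o + d.rot (0, 1)) d L (H + 1) := by
  refine ⟨hs.hL, by omega, fun x y h3 h4 h5 h6 => ?_, ?_⟩
  · rw [add_assoc, ← Dir.rot_add]
    simp only [Prod.mk_add_mk, zero_add]
    push_cast at h5
    have h7 := hs.sub x (-1) h3 h4 (by have := hs.hH; omega) (by omega)
    rcases eq_or_lt_of_le h6 with rfl | h6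
    -- A single tile in the lane puts the whole lane along the side into the bounding rectangle.
    · simpa using rect_mix h7 (mem_rect_zero (by simpa [localTiles] using hi))
    · exact hs.sub _ _ h3 h4 (by omega) (by omega)
  · obtain ⟨i, j, h1, h2, h3, h4, h5⟩ := hs.tile
    refine ⟨i, j - 1, h1, h2, by push_cast; omega, by omega, ?_⟩
    rw [localTiles_translate]
    simpa using h5

end Inside

/-! ## The bounds that hold at any time -/

/-- The robot is close to the bounding rectangle, and there are few additional tiles. -/
def Controlled (P : Finset Pixel) (c : World (BotState × Dir)) : Prop :=
  c.pos ∈ rect P 1 ∧ ∃ S : Finset Pixel, S.card ≤ 22 * (width P + height P) + 484 ∧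
    ∀ p, c.grid p = true → p ∈ P ∨ p ∈ S

theorem span_add_span (d : Dir) (P : Finset Pixel) :
    d.span P + d.turn.span P = width P + height P := by
  cases d <;> simp [Dir.span, Dir.turn, add_comm]

/-- The ring has `(L + 22) * (H + 22) - L * H = 22 * (L + H) + 484` pixels, which explains the
constants in `Controlled`. -/
theorem controlled_of_ring {P : Finset Pixel} {o : Pixel} {d : Dir} {L H : ℕ}
    (hs : Inside P o d L H) {h : Pixel → Bool}
    (hh : ∀ i j : ℤ, h (i, j) = true → localTiles P o d (i, j) = true ∨
      (-10 ≤ i ∧ i ≤ L + 11 ∧ -H - 11 ≤ j ∧ j ≤ 10) ∧ ¬ (1 ≤ i ∧ i ≤ L ∧ -H ≤ j ∧ j ≤ -1))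
    (q : BotState) {i : ℤ} (h0 : 0 ≤ i) (h1 : i ≤ L + 1) :
    Controlled P (localWorld q o d (i, 0) h) := by
  have hL := hs.hL
  have hH := hs.hH
  refine ⟨?_, ?_⟩
  · have := hs.sub (max 1 (min i L)) (-1) (by omega) (by omega) (by omega) (by omega)
    have := rect_near (z := (i, 0)) (m := 1) this (by rw [abs_le]; simp only; omega) (by simp)
    simpa [localWorld] using this
  · refine ⟨((Finset.Icc (-10 : ℤ) (L + 11) ×ˢ Finset.Icc (-H - 11 : ℤ) 10) \
      (Finset.Icc (1 : ℤ) L ×ˢ Finset.Icc (-H : ℤ) (-1))).image fun z => o + d.rot z, ?_, ?_⟩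
    · refine Finset.card_image_le.trans ?_
      rw [Finset.card_sdiff_of_subset]
      · simp only [Finset.card_product, Int.card_Icc]
        have e1 : ((L : ℤ) + 11 + 1 - -10).toNat = L + 22 := by omega
        have e2 : ((10 : ℤ) + 1 - (-H - 11)).toNat = H + 22 := by omega
        have e3 : ((L : ℤ) + 1 - 1).toNat = L := by omega
        have e4 : ((-1 : ℤ) + 1 - -H).toNat = H := by omega
        rw [e1, e2, e3, e4, ← span_add_span d]
        obtain ⟨h1, h2⟩ := hs.le_span
        rw [Nat.sub_le_iff_le_add]
        nlinarith
      · intro z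
        simp only [Finset.mem_product, Finset.mem_Icc]
        omega
    · intro p hp
      obtain ⟨z, rfl⟩ := exists_local o d p
      simp only [localWorld, add_sub_cancel_left, Dir.rot_rot] at hp
      rcases hh z.1 z.2 hp with h | h
      · exact .inl (by simpa [localTiles] using h)
      · refine .inr (Finset.mem_image.2 ⟨z, ?_, rfl⟩)
        simp only [Finset.mem_sdiff, Finset.mem_product, Finset.mem_Icc]
        omega

theorem Marked.controlled {P : Finset Pixel} {o : Pixel} {d : Dir} {L H : ℕ} {s t : ℤ}
    {h : Pixel → Bool} (hm : Marked (localTiles P o d) h L H s t) (hs : Inside P o d L H)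
    (hs0 : 0 ≤ s) (hs1 : s ≤ 1) (ht0 : 0 ≤ t) (ht1 : t ≤ 1)
    (q : BotState) {i : ℤ} (h0 : 0 ≤ i) (h1 : i ≤ L + 1) :
    Controlled P (localWorld q o d (i, 0) h) := by
  refine controlled_of_ring hs (fun x y hxy => ?_) q h0 h1
  by_cases hr : (-10 ≤ x ∧ x ≤ L + 11 ∧ -H - 11 ≤ y ∧ y ≤ 10) ∧
      ¬ (1 ≤ x ∧ x ≤ L ∧ -H ≤ y ∧ y ≤ -1)
  · exact .inr hr
  · rw [← hm.rest x y (by omega) (by omega) (by omega) (by omega)]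
    exact .inl hxy

/-! ## Finding the bounding rectangle -/

theorem markerAt_ahead (h : Pixel → Bool) (i : ℤ) : markerAt (view 11 (i, 0) h) 1 =
    (!h (i + 1, 0) && h (i + 1, 1) && h (i + 2, 0) && !h (i + 2, 1)) := by
  simp only [markerAt]
  rw [view_pair, view_pair, view_pair, view_pair] <;> norm_num

theorem markerAt_behind (h : Pixel → Bool) (i : ℤ) : markerAt (view 11 (i, 0) h) (-1) =
    (!h (i - 1, 0) && h (i - 1, 1) && h (i - 2, 0) && !h (i - 2, 1)) := by
  simp only [markerAt]
  rw [view_pair, view_pair, view_pair, view_pair] <;> norm_num [sub_eq_add_neg]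

namespace Marked

variable {p h : Pixel → Bool} {L H s t : ℤ}

theorem markerAt_end (hm : Marked p h L H 0 0) : markerAt (view 11 (L, 0) h) 1 = true := by
  obtain ⟨h1, h2, h3, h4⟩ := hm.finish_marker
  rw [zero_add] at h3 h4
  simp [markerAt_ahead, h1, h2, h3, h4]

/-- A square within the side shows the chess-free `p`. The square straddling the end of the side
contains the empty pixel `(L + 1, 0)`, where the pattern would need a tile. -/
theorem markerAt_inner (hm : Marked p h L H 0 0) (hp : ChessFree p) {i : ℤ} (h0 : 0 ≤ i)
    (h1 : i < L) : markerAt (view 11 (i, 0) h) 1 = false := by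
  rw [markerAt_ahead]
  by_cases hi : i + 2 ≤ L
  · rw [hm.lane (by omega) (by omega), hm.lane (by omega) (by omega), hm.lane (by omega) hi,
      hm.lane (by omega) hi]
    have := hp (i + 1) 0
    rw [show i + 1 + 1 = i + 2 by ring, zero_add] at this
    cases h1 : p (i + 1, 0) <;> cases h2 : p (i + 1, 1) <;> cases h3 : p (i + 2, 0) <;>
      cases h4 : p (i + 2, 1) <;> simp_all
  · obtain rfl : L = i + 1 := by omega
    have := hm.finish_marker.1
    rw [show i + 1 + 1 = i + 2 by ring] at this
    simp [this]

theorem markerAt_begin (hm : Marked p h L H 0 t) : markerAt (view 11 (1, 0) h) (-1) = true := by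
  obtain ⟨h1, h2, h3, h4⟩ := hm.start_marker
  rw [zero_add] at h3 h4
  simp [markerAt_behind, h1, h2, h3, h4]

theorem markerAt_inner_back (hm : Marked p h L H 0 t) (hp : ChessFree p) {i : ℤ}
    (h0 : 1 < i) (h1 : i ≤ L + 1) : markerAt (view 11 (i, 0) h) (-1) = false := by
  rw [markerAt_behind]
  by_cases hi : 3 ≤ i
  · rw [hm.lane (by omega) (by omega), hm.lane (by omega) (by omega),
      hm.lane (by omega) (by omega), hm.lane (by omega) (by omega)]
    have := hp (i - 2) 0
    rw [show i - 2 + 1 = i - 1 by ring, zero_add] at this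
    cases h1 : p (i - 1, 0) <;> cases h2 : p (i - 1, 1) <;> cases h3 : p (i - 2, 0) <;>
      cases h4 : p (i - 2, 1) <;> simp_all
  · obtain rfl : i = 2 := by omega
    simp [hm.start_marker.1]

end Marked

/-! ### Following and pushing one side -/

section

variable {P : Finset Pixel} {o : Pixel} {d : Dir} {L H : ℕ} {h : Pixel → Bool}

/-- Following a side. -/
theorem reach_scan (hP : IsPolyomino P) (hs : Inside P o d L H)
    (hm : Marked (localTiles P o d) h L H 0 0) (k : Fin 3) (prod : Bool) (n : ℕ) :
    ∀ (i : ℕ) (flag : Bool), i + n = L →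
      ∃ flag', (flag' = true ↔ flag = true ∨
        ∃ x : ℤ, i < x ∧ x ≤ L ∧ localTiles P o d (x, 0) = true) ∧
      ReachLe bot.step (Controlled P) n (localWorld (.scan k prod flag) o d (i, 0) h)
        (localWorld (.scan k prod flag') o d (L, 0) h) := by
  induction n with
  | zero =>
    intro i flag hi
    obtain rfl : i = L := by omega
    refine ⟨flag, ⟨.inl, ?_⟩, .refl (hm.controlled hs le_rfl zero_le_one le_rfl zero_le_one _
      (by omega) (by omega))⟩
    rintro (h | ⟨x, h1, h2, -⟩)
    · exact h
    · omega
  | succ n ih =>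
    intro i flag hi
    obtain ⟨flag', h1, h2⟩ := ih (i + 1) (flag || localTiles P o d (i + 1, 0)) (by omega)
    refine ⟨flag', ?_, ?_⟩
    · rw [h1, Bool.or_eq_true, or_assoc]
      refine or_congr_right ⟨?_, ?_⟩
      · rintro (h | ⟨x, h3, h4, h5⟩)
        · exact ⟨i + 1, by omega, by omega, h⟩
        · exact ⟨x, by omega, h4, h5⟩
      · rintro ⟨x, h3, h4, h5⟩
        rcases eq_or_lt_of_le (show (i : ℤ) + 1 ≤ x by omega) with rfl | h
        · exact .inl h5
        · exact .inr ⟨x, by push_cast; omega, h4, h5⟩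
    · refine .cons (hm.controlled hs le_rfl zero_le_one le_rfl zero_le_one _
        (by omega) (by omega)) ?_ h2
      have hr : rule (.scan k prod flag) (view 11 ((i : ℤ), 0) h) =
          some (.scan k prod (flag || localTiles P o d (i + 1, 0)), view 11 ((i : ℤ), 0) h,
            .fwd, false) := by
        simp only [rule]
        rw [hm.markerAt_inner (localTiles_chessFree hP o d) (by omega) (by omega),
          view_pair (by omega) (by omega) (by omega) (by omega), add_zero,
          hm.lane (by omega) (by omega)]
        simp
      rw [bot_step hr, overwrite_view]
      congr 2

/-- Returning along a side after the marker at its end has been shifted. -/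
theorem reach_back (hP : IsPolyomino P) (hs : Inside P o d L H)
    (hm : Marked (localTiles P o d) h L H 0 1) (k : Fin 3) (n : ℕ) (hn : n ≤ L) :
    ReachLe bot.step (Controlled P) n (localWorld (.back k) o d (n + 1, 0) h)
        (localWorld (.back k) o d (1, 0) h) := by
  induction n with
  | zero => simpa using ReachLe.refl (hm.controlled hs le_rfl zero_le_one zero_le_one le_rfl
      (.back k) (i := 1) (by omega) (by omega))
  | succ n ih =>
    refine .cons (hm.controlled hs le_rfl zero_le_one zero_le_one le_rfl _ (by omega)
      (by omega)) ?_ (ih (by omega))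
    have hr : rule (.back k) (view 11 (((n + 1 : ℕ) : ℤ) + 1, 0) h) =
        some (.back k, view 11 (((n + 1 : ℕ) : ℤ) + 1, 0) h, .back, false) := by
      simp only [rule]
      rw [hm.markerAt_inner_back (localTiles_chessFree hP o d) (by omega) (by omega)]
      simp
    rw [bot_step hr, overwrite_view]
    congr 2
    simp [Act.vec]

/-- One side grows. -/
theorem reach_grow (hP : IsPolyomino P) (hs : Inside P o d L H)
    (hm : Marked (localTiles P o d) h L H 0 0) {k : Fin 3} (hk : k ≠ 1) (prod : Bool)
    (ht : ∃ x : ℤ, 0 < x ∧ x ≤ L ∧ localTiles P o d (x, 0) = true) :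
    ∃ h', Inside P (o + d.rot (0, 1)) d L (H + 1) ∧
      Marked (localTiles P (o + d.rot (0, 1)) d) h' L ((H + 1 : ℕ) : ℤ) 0 0 ∧
      ReachLe bot.step (Controlled P) (L + 2) (localWorld (.scan k prod true) o d (L, 0) h)
        (localWorld (.scan k true (localTiles P (o + d.rot (0, 1)) d (1, 0)))
          (o + d.rot (0, 1)) d (1, 0) h') := by
  have hfree := localTiles_chessFree hP o d
  have hL := hs.hL
  have hH := hs.hH
  obtain ⟨x, -, -, hx⟩ := ht
  have hs' := hs.grow hx
  have hm1 := hm.shiftAhead hfree (by omega) (by omega)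
  have hm2 := hm1.shiftBehind hfree (by omega) (by omega)
  have hm3 := hm2.grow
  rw [← localTiles_translate] at hm3
  refine ⟨_, hs', by exact_mod_cast hm3, ?_⟩
  have hr1 : rule (.scan k prod true) (view 11 ((L : ℤ), 0) h) =
      some (.back k, shiftAhead (view 11 ((L : ℤ), 0) h), .fwd, false) := by
    simp [rule, hm.markerAt_end, hk]
  have hc := hm.controlled hs le_rfl zero_le_one le_rfl zero_le_one (.scan k prod true)
    (i := L) (by omega) (by omega)
  -- The `L + 2` steps are one that shifts the marker ahead, `L` steps back, and one that shifts the
  -- marker behind.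
  refine .cons hc (bot_step hr1 o d) ?_
  have e1 : ((L : ℤ), (0 : ℤ)) + Act.fwd.vec = ((L : ℤ) + 1, 0) := by simp [Act.vec]
  rw [e1]
  refine (reach_back hP hs hm1 k L le_rfl).trans ?_
  set h1 := overwrite 11 ((L : ℤ), 0) (shiftAhead (view 11 ((L : ℤ), 0) h)) h with hh1
  have hr2 : rule (.back k) (view 11 (1, 0) h1) =
      some (.scan k true (localTiles P (o + d.rot (0, 1)) d (1, 0)),
        shiftBehind (view 11 (1, 0) h1), .out, false) := by
    simp only [rule]
    rw [hm1.markerAt_begin, view_pair (by omega) (by omega) (by omega) (by omega), add_zero,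
      hm1.lane (by omega) (by omega), localTiles_translate]
    simp
  refine .cons (hm1.controlled hs le_rfl zero_le_one zero_le_one le_rfl _ (by omega)
    (by omega)) (bot_step hr2 o d) ?_
  have e2 : ((1 : ℤ), (0 : ℤ)) + Act.out.vec = (0, 1) + (1, 0) := by simp [Act.vec]
  rw [e2, localWorld_translate]
  refine .refl (Marked.controlled ?_ hs' le_rfl zero_le_one le_rfl zero_le_one _
    (by omega) (by omega))
  exact_mod_cast hm3

end

/-- The robot is about to follow a side of a marked rectangle. -/
structure Placed (P : Finset Pixel) (o : Pixel) (d : Dir) (L H : ℕ) (h : Pixel → Bool) : Prop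
    extends Inside P o d L H where
  marked : Marked (localTiles P o d) h L H 0 0

/-- There are no tiles in the lane along the side that the robot follows. -/
def ClearSide (P : Finset Pixel) (o : Pixel) (d : Dir) (L : ℕ) : Prop :=
  ∀ i : ℤ, 1 ≤ i → i ≤ L → localTiles P o d (i, 0) = false

/-- There are no tiles in the lane along the next side. -/
def ClearNext (P : Finset Pixel) (o : Pixel) (d : Dir) (L H : ℕ) : Prop :=
  ∀ j : ℤ, -H ≤ j → j ≤ -1 → localTiles P o d (L + 1, j) = false

/-- There are no tiles in the lane along the opposite side. -/
def ClearOpp (P : Finset Pixel) (o : Pixel) (d : Dir) (L H : ℕ) : Prop :=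
  ∀ i : ℤ, 1 ≤ i → i ≤ L → localTiles P o d (i, -H - 1) = false

/-- There are no tiles in the lane along the previous side. -/
def ClearPrev (P : Finset Pixel) (o : Pixel) (d : Dir) (H : ℕ) : Prop :=
  ∀ j : ℤ, -H ≤ j → j ≤ -1 → localTiles P o d (0, j) = false

/-! ### Clear lanes, sides and phases -/

section

variable {P : Finset Pixel} {o : Pixel} {d : Dir} {L H : ℕ} {h : Pixel → Bool}

theorem Placed.turn (hpl : Placed P o d L H h) :
    Placed P (o + d.rot (L + 1, 0)) d.turn H L (h ∘ turnAt (L + 1, 0)) :=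
  { toInside := hpl.toInside.turn
    marked := by rw [localTiles_turn]; exact hpl.marked.turn }

theorem Placed.controlled (hpl : Placed P o d L H h) (q : BotState) {i : ℤ} (h0 : 0 ≤ i)
    (h1 : i ≤ L + 1) : Controlled P (localWorld q o d (i, 0) h) :=
  hpl.marked.controlled hpl.toInside le_rfl zero_le_one le_rfl zero_le_one q h0 h1

/-- A left turn renames the lanes cyclically: the side just followed becomes the previous one, the
previous one the opposite one, and so on. -/
theorem ClearSide.turn (hc : ClearSide P o d L) :
    ClearPrev P (o + d.rot (L + 1, 0)) d.turn L := by
  intro j h1 h2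
  rw [localTiles_turn]
  simpa [turnAt] using hc (L + 1 + j) (by omega) (by omega)

theorem ClearNext.turn (hc : ClearNext P o d L H) :
    ClearSide P (o + d.rot (L + 1, 0)) d.turn H := by
  intro i h1 h2
  rw [localTiles_turn]
  simpa [turnAt] using hc (-i) (by omega) (by omega)

theorem ClearOpp.turn (hc : ClearOpp P o d L H) :
    ClearNext P (o + d.rot (L + 1, 0)) d.turn H L := by
  intro j h1 h2
  rw [localTiles_turn]
  have := hc (L + 1 + j) (by omega) (by omega)
  simp only [turnAt, Function.comp]
  convert this using 2
  ext <;> simp; ring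

theorem ClearPrev.turn (hc : ClearPrev P o d H) :
    ClearOpp P (o + d.rot (L + 1, 0)) d.turn H L := by
  intro i h1 h2
  rw [localTiles_turn]
  have := hc (-i) (by omega) (by omega)
  simp only [turnAt, Function.comp]
  convert this using 2
  ext <;> simp

/-- Pushing the front side does not move the opposite lane; only its local coordinate changes. -/
theorem ClearOpp.grow (hc : ClearOpp P o d L H) :
    ClearOpp P (o + d.rot (0, 1)) d L (H + 1) := by
  intro i h1 h2
  rw [localTiles_translate]
  have := hc i h1 h2
  convert this using 2
  ext <;> simp
  ring

/-- One side grows as far as possible. -/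
theorem reach_side (hP : IsPolyomino P) {k : Fin 3} (hk : k ≠ 1) (r : ℕ) :
    ∀ (o : Pixel) (H : ℕ) (h : Pixel → Bool) (prod flag : Bool) (i : ℕ),
      Placed P o d L H h → r + H = d.turn.span P → i ≤ 1 →
      (flag = true ↔ ∃ x : ℤ, 0 < x ∧ x ≤ i ∧ localTiles P o d (x, 0) = true) →
      ∃ o' h' m, Placed P o' d L (H + m) h' ∧ ClearSide P o' d L ∧
        (ClearOpp P o d L H → ClearOpp P o' d L (H + m)) ∧ (m = 0 → o' = o) ∧
        ReachLe bot.step (Controlled P) (L + m * (2 * L + 2))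
          (localWorld (.scan k prod flag) o d (i, 0) h)
          (localWorld (.scan k (prod || decide (m ≠ 0)) false) o' d (L, 0) h') := by
  -- `r` counts the rows by which the side can still grow according to `Inside.le_span`.
  induction r with
  | zero =>
    intro o H h prod flag i hpl hr hi hflag
    obtain ⟨flag', h1, h2⟩ := reach_scan hP hpl.toInside hpl.marked k prod (L - i) i flag
      (by have := hpl.hL; omega)
    cases flag' with
    | false =>
      refine ⟨o, h, 0, hpl, ?_, fun h => h, fun _ => rfl, by
        simpa using h2.mono (by omega)⟩
      intro x hx hx'
      by_contra hc
      rw [Bool.not_eq_false] at hc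
      have : ¬ (flag = true ∨ _) := fun h => by simpa using h1.2 h
      rw [hflag] at this
      rcases lt_or_ge (i : ℤ) x with h | h
      · exact this (.inr ⟨x, h, hx', hc⟩)
      · exact this (.inl ⟨x, by omega, h, hc⟩)
    | true =>
      -- Another row would stick out of the bounding rectangle.
      exfalso
      have : ∃ x : ℤ, localTiles P o d (x, 0) = true := by
        rcases h1.1 rfl with h | ⟨x, -, -, h⟩
        · obtain ⟨x, -, -, h⟩ := hflag.1 h
          exact ⟨x, h⟩
        · exact ⟨x, h⟩
      obtain ⟨x, hx⟩ := this
      have := (hpl.toInside.grow hx).le_span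
      omega
  | succ r ih =>
    intro o H h prod flag i hpl hr hi hflag
    obtain ⟨flag', h1, h2⟩ := reach_scan hP hpl.toInside hpl.marked k prod (L - i) i flag
      (by have := hpl.hL; omega)
    cases flag' with
    | false =>
      refine ⟨o, h, 0, hpl, ?_, fun h => h, fun _ => rfl, by
        simpa using h2.mono (by omega)⟩
      intro x hx hx'
      by_contra hc
      rw [Bool.not_eq_false] at hc
      have : ¬ (flag = true ∨ _) := fun h => by simpa using h1.2 h
      rw [hflag] at this
      rcases lt_or_ge (i : ℤ) x with h | h
      · exact this (.inr ⟨x, h, hx', hc⟩)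
      · exact this (.inl ⟨x, by omega, h, hc⟩)
    | true =>
      have hL := hpl.hL
      have : ∃ x : ℤ, 0 < x ∧ x ≤ L ∧ localTiles P o d (x, 0) = true := by
        rcases h1.1 rfl with h | ⟨x, h3, h4, h⟩
        · obtain ⟨x, h3, h4, h⟩ := hflag.1 h
          exact ⟨x, h3, by omega, h⟩
        · exact ⟨x, by omega, h4, h⟩
      obtain ⟨h', hs', hm', h3⟩ := reach_grow hP hpl.toInside hpl.marked hk prod this
      -- The robot enters the new lane at its first pixel, so the scan resumes at index 1 with that
      -- pixel already recorded in the flag.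
      obtain ⟨o'', h'', m, g1, g2, g3, g4, g5⟩ := ih _ _ h' true
        (localTiles P (o + d.rot (0, 1)) d (1, 0)) 1 ⟨hs', hm'⟩ (by omega) le_rfl (by
          constructor
          · intro h
            exact ⟨1, by omega, by simp, h⟩
          · rintro ⟨x, h3, h4, h5⟩
            obtain rfl : x = 1 := by push_cast at h4; omega
            exact h5)
      refine ⟨o'', h'', m + 1, ?_, g2, ?_, by simp, ?_⟩
      · rwa [show H + (m + 1) = H + 1 + m by ring]
      · rw [show H + (m + 1) = H + 1 + m by ring]
        exact fun h => g3 h.grow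
      · have := (h2.trans h3).trans g5
        simp only [Bool.true_or] at this
        simp only [ne_eq, Nat.add_eq_zero_iff, one_ne_zero, and_false, not_false_eq_true,
          decide_true, Bool.or_true]
        refine this.mono ?_
        rw [Nat.add_mul]
        omega

/-- A left turn at the end of a side, without any change of the grid. -/
theorem Placed.step_turn (hpl : Placed P o d L H h) {q q' : BotState}
    (hr : rule q (view 11 ((L : ℤ), 0) h) = some (q', view 11 ((L : ℤ), 0) h, .fwd, true)) :
    ReachLe bot.step (Controlled P) 1 (localWorld q o d (L, 0) h)
      (localWorld q' (o + d.rot (L + 1, 0)) d.turn 0 (h ∘ turnAt (L + 1, 0))) := by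
  refine .cons (hpl.controlled _ (by omega) (by omega)) ?_
    (.refl (hpl.turn.controlled _ le_rfl (by omega)))
  rw [bot_step_turn hr, overwrite_view]
  simp [Act.vec]

theorem no_tile_yet : (false = true ↔
    ∃ x : ℤ, 0 < x ∧ x ≤ ((0 : ℕ) : ℤ) ∧ localTiles P o d (x, 0) = true) := by
  simp only [Bool.false_eq_true, false_iff]
  rintro ⟨x, h1, h2, -⟩
  simp at h2
  omega

/-- A phase: two opposite sides grow as far as possible. -/
theorem reach_phase (hP : IsPolyomino P) (hpl : Placed P o d L H h) (prod flag : Bool) {i : ℕ}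
    (hi : i ≤ 1)
    (hf : flag = true ↔ ∃ x : ℤ, 0 < x ∧ x ≤ i ∧ localTiles P o d (x, 0) = true) :
    ∃ o' h' m, Placed P o' d.turn.turn.turn (H + m) L h' ∧
      ClearNext P o' d.turn.turn.turn (H + m) L ∧ ClearPrev P o' d.turn.turn.turn L ∧
      (m = 0 → ClearNext P o d L H → ClearPrev P o d H →
        ClearSide P o' d.turn.turn.turn (H + m) ∧ ClearOpp P o' d.turn.turn.turn (H + m) L) ∧
      ReachLe bot.step (Controlled P) (5 * L * m + 5 * (L + H))
        (localWorld (.scan 0 prod flag) o d (i, 0) h)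
        (localWorld (if prod || decide (m ≠ 0) then .scan 0 false false else .build 3 true)
          o' d.turn.turn.turn 0 h') := by
  obtain ⟨o1, h1, m1, p1, c1, -, e1, r1⟩ := reach_side hP (k := 0) (by decide)
    (d.turn.span P - H) o H h prod flag i hpl (by have := hpl.le_span; omega) hi hf
  have t1 := p1.step_turn (q := .scan 0 (prod || decide (m1 ≠ 0)) false)
    (q' := .scan 1 (prod || decide (m1 ≠ 0)) false) (by simp [rule, p1.marked.markerAt_end])
  have p2 := p1.turn
  -- The middle side is only followed; whether its lane contains tiles is ignored.
  obtain ⟨flag', -, r2⟩ := reach_scan hP p2.toInside p2.marked 1 (prod || decide (m1 ≠ 0))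
    (H + m1) 0 false (by omega)
  have t2 := p2.step_turn (q := .scan 1 (prod || decide (m1 ≠ 0)) flag')
    (q' := .scan 2 (prod || decide (m1 ≠ 0)) false) (by simp only [rule, p2.marked.markerAt_end]; simp)
  have p3 := p2.turn
  obtain ⟨o4, h4, m2, p4, c4, cc4, e4, r4⟩ := reach_side hP (k := 2) (by decide)
    (d.turn.turn.turn.span P - (H + m1)) _ (H + m1) _ (prod || decide (m1 ≠ 0)) false 0 p3
    (by have := p3.le_span; omega) zero_le_one no_tile_yet
  have t4 := p4.step_turn (q := .scan 2 (prod || decide (m1 ≠ 0) || decide (m2 ≠ 0)) false)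
    (q' := if prod || decide (m1 + m2 ≠ 0) then .scan 0 false false else .build 3 true) (by
      simp [rule, p4.marked.markerAt_end]
      cases prod <;> by_cases hm1 : m1 = 0 <;> by_cases hm2 : m2 = 0 <;> simp [hm1, hm2])
  refine ⟨_, _, m1 + m2, by simpa [add_assoc] using p4.turn, ?_, c4.turn, ?_, ?_⟩
  -- After two turns the first side is the opposite one. Its lane stays clear while the third side
  -- grows, and the last turn makes it the next side.
  · have := (cc4 c1.turn.turn).turn
    simpa [add_assoc] using this
  · intro hm hn hp
    -- Without growth the rectangle has not moved, so the two lanes known to be clear before the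
    -- phase still are.
    obtain ⟨rfl, rfl⟩ : m1 = 0 ∧ m2 = 0 := by omega
    obtain rfl := e1 rfl
    obtain rfl := e4 rfl
    constructor
    · have : ClearNext P _ d.turn.turn L H :=
        ClearOpp.turn (L := H) (H := L) (ClearPrev.turn (L := L) hp)
      simpa using this.turn
    · have : ClearPrev P _ d.turn.turn H := ClearSide.turn (ClearNext.turn hn)
      simpa using this.turn (L := L)
  · have := ((((r1.trans t1).trans r2).trans t2).trans r4).trans t4
    refine this.mono ?_
    have h1 := hpl.hL
    have h2 := hpl.hH
    nlinarith [Nat.zero_le (m1 * L), Nat.zero_le (m2 * L), Nat.mul_le_mul_left m1 h1,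
      Nat.mul_le_mul_left m2 h1]

end

/-- The search for the bounding rectangle. -/
theorem reach_rectangle {P : Finset Pixel} (hP : IsPolyomino P) (N : ℕ) :
    ∀ (o : Pixel) (d : Dir) (L H a b : ℕ) (h : Pixel → Bool), Placed P o d L H h →
      ClearNext P o d L H → ClearPrev P o d H → H + a = d.turn.span P → L + b = d.span P →
      (2 * a + 1 ≤ N ∨ 2 * b + 2 ≤ N) →
      ∃ o' d' L' H' h', Placed P o' d' L' H' h' ∧ ClearSide P o' d' L' ∧ ClearNext P o' d' L' H' ∧
        ClearOpp P o' d' L' H' ∧ ClearPrev P o' d' H' ∧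
        ReachLe bot.step (Controlled P) (5 * (d.span P * a) + 5 * (d.turn.span P * b) +
            5 * ((d.span P + d.turn.span P) * N))
          (localWorld (.scan 0 false false) o d 0 h) (localWorld (.build 3 true) o' d' 0 h') := by
  -- `a` and `b` count the missing rows in the two directions, and `N` bounds the number of
  -- remaining phases. A productive phase decreases `a` and exchanges the roles of `a` and `b`.
  -- Following either one of the counters bounds the phases, hence the smaller one may be used.
  induction N with
  | zero => intros; omega
  | succ N ih =>
    intro o d L H a b h hpl hn hp ha hb hN
    obtain ⟨o', h', m, p1, c1, c2, c3, r⟩ := reach_phase hP hpl false false zero_le_one no_tile_yet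
    by_cases hm : m = 0
    · obtain ⟨c4, c5⟩ := c3 hm hn hp
      refine ⟨o', _, _, _, h', p1, c4, c1, c5, c2, ?_⟩
      simp only [hm, ne_eq, not_true_eq_false, decide_false, Bool.or_self, Bool.false_eq_true,
        if_false] at r
      refine r.mono ?_
      obtain ⟨h1, h2⟩ := hpl.le_span
      nlinarith [Nat.zero_le (d.span P * a), Nat.zero_le (d.turn.span P * b),
        Nat.zero_le ((d.span P + d.turn.span P) * N)]
    · have hle := p1.le_span
      simp only [Dir.span_turn_turn] at hle
      obtain ⟨a', rfl⟩ := Nat.exists_eq_add_of_le (show m ≤ a by omega)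
      obtain ⟨o2, d2, L2, H2, h2, g1, g2, g3, g4, g5, r2⟩ := ih o' _ _ _ b a' h' p1 c1 c2
        (by simp only [Dir.span_turn_turn]; omega) (by simp only [Dir.span_turn_turn]; omega)
        (by omega)
      refine ⟨o2, d2, L2, H2, h2, g1, g2, g3, g4, g5, ?_⟩
      simp only [ne_eq, hm, not_false_eq_true, decide_true, Bool.or_true, if_true] at r
      refine (r.trans r2).mono ?_
      simp only [Dir.span_turn_turn]
      obtain ⟨h1, h2⟩ := hpl.le_span
      -- The cost `5 * L * m` of the growth is paid for by the decrease of `a` by `m`.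
      have := Nat.mul_le_mul_right m h1
      nlinarith

/-! ## The rectangle contains the polyomino -/

/-- Connectedness in the form in which it confines `P` to a rectangle and yields intermediate values
of a coordinate. -/
theorem IsPolyomino.induct {P : Finset Pixel} (hP : IsPolyomino P) (S : Pixel → Prop) {s : Pixel}
    (hs : s ∈ P) (hS : S s)
    (hstep : ∀ p ∈ P, ∀ q ∈ P, gridGraph.Adj p q → S p → S q) : ∀ q ∈ P, S q := by
  intro q hq
  obtain ⟨W⟩ := hP.connected.preconnected ⟨s, hs⟩ ⟨q, hq⟩
  have : ∀ (a b : (P : Set Pixel)), (gridGraph.induce (P : Set Pixel)).Walk a b → S a → S b := by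
    intro a b W
    induction W with
    | nil => exact id
    | cons hadj _ ih => exact fun h => ih (hstep _ (Subtype.prop _) _ (Subtype.prop _) hadj h)
  exact this _ _ W hS

/-- All tiles lie in the local rectangle. -/
def Encloses (P : Finset Pixel) (o : Pixel) (d : Dir) (L H : ℕ) : Prop :=
  ∀ i j : ℤ, localTiles P o d (i, j) = true → 1 ≤ i ∧ i ≤ L ∧ -H ≤ j ∧ j ≤ -1

section

variable {P : Finset Pixel} {o : Pixel} {d : Dir} {L H : ℕ}

/-- A first step out of the rectangle would enter one of the four lanes. Pixels diagonal to its
corners share no edge with it, so they need not be inspected. -/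
theorem Inside.encloses (hP : IsPolyomino P) (hs : Inside P o d L H) (h0 : ClearSide P o d L)
    (h1 : ClearNext P o d L H) (h2 : ClearOpp P o d L H) (h3 : ClearPrev P o d H) :
    Encloses P o d L H := by
  obtain ⟨i₀, j₀, hi, hi', hj, hj', ht⟩ := hs.tile
  have key := hP.induct (fun q => 1 ≤ (d.rot (q - o)).1 ∧ (d.rot (q - o)).1 ≤ L ∧
    -H ≤ (d.rot (q - o)).2 ∧ (d.rot (q - o)).2 ≤ -1) (s := o + d.rot (i₀, j₀))
    (by simpa [localTiles] using ht) (by simp [*]) ?_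
  · intro i j hij
    simpa using key (o + d.rot (i, j)) (by simpa [localTiles] using hij)
  · intro p hp q hq hadj
    obtain ⟨⟨x, y⟩, rfl⟩ := exists_local o d p
    obtain ⟨⟨u, v⟩, rfl⟩ := exists_local o d q
    rw [gridGraph_adj_rot, gridGraph_adj, abs_eq_max_neg, abs_eq_max_neg] at hadj
    simp only [add_sub_cancel_left, Dir.rot_rot]
    have hq' : localTiles P o d (u, v) = true := by simpa [localTiles] using hq
    rintro ⟨a1, a2, a3, a4⟩
    simp only at hadj
    by_contra hc
    have : (v = 0 ∧ 1 ≤ u ∧ u ≤ L) ∨ (v = -H - 1 ∧ 1 ≤ u ∧ u ≤ L) ∨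
        (u = L + 1 ∧ -H ≤ v ∧ v ≤ -1) ∨ (u = 0 ∧ -H ≤ v ∧ v ≤ -1) := by omega
    rcases this with ⟨rfl, h, h'⟩ | ⟨rfl, h, h'⟩ | ⟨rfl, h, h'⟩ | ⟨rfl, h, h'⟩
    · simp [h0 u h h'] at hq'
    · simp [h2 u h h'] at hq'
    · simp [h1 v h h'] at hq'
    · simp [h3 v h h'] at hq'

theorem Encloses.turn (he : Encloses P o d L H) :
    Encloses P (o + d.rot (L + 1, 0)) d.turn H L := by
  intro i j hij
  rw [localTiles_turn] at hij
  have := he _ _ hij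
  simp only at this
  omega

end

/-! ## Building the box -/

/-- One colour class of the chessboard. -/
def chess (e : ℤ) (q : Pixel) : Bool := decide (Even (q.1 + q.2 + e))

/-- Headings preserve the parity of the coordinate sum. Hence one bit, the colour of its own pixel,
tells the robot the colours in its window. -/
theorem chess_rot (e : ℤ) (o : Pixel) (d : Dir) (y z : Pixel) :
    chess e (o + d.rot (y + z)) = xor (chess e (o + d.rot y)) (decide (Odd (z.1 + z.2))) := by
  simp only [chess]
  rw [Bool.eq_iff_iff, Bool.xor_iff_ne, ne_eq, decide_eq_decide, decide_eq_true_iff]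
  simp only [Int.even_iff, Int.odd_iff]
  cases d <;> simp only [Dir.rot, Prod.fst_add, Prod.snd_add] <;> omega

/-- The chessboard in local coordinates. -/
def localChess (e : ℤ) (o : Pixel) (d : Dir) : Pixel → Bool := fun z => chess e (o + d.rot z)

theorem localChess_turn (e : ℤ) (o : Pixel) (d : Dir) (a : Pixel) :
    localChess e (o + d.rot a) d.turn = localChess e o d ∘ turnAt a := by
  ext z
  simp only [localChess, Function.comp, rot_turnAt]

theorem localChess_add (e : ℤ) (o : Pixel) (d : Dir) (x y u v : ℤ) :
    localChess e o d (x + u, y + v) = xor (localChess e o d (x, y)) (decide (Odd (u + v))) :=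
  chess_rot e o d (x, y) (u, v)

/-- The pixels of the lanes at distances two and three around `[1, L] × [-H, -1]`, without the
outer corners. -/
abbrev OnLanes (L H i j : ℤ) : Prop :=
  (-2 ≤ i ∧ i ≤ L + 3 ∧ -H - 3 ≤ j ∧ j ≤ 2) ∧ ¬ (0 ≤ i ∧ i ≤ L + 1 ∧ -H - 1 ≤ j ∧ j ≤ 0) ∧
    ¬ ((i = -2 ∨ i = L + 3) ∧ (j = 2 ∨ j = -H - 3))

/-- The final grid in local coordinates. -/
def goal (p c : Pixel → Bool) (L H : ℤ) : Pixel → Bool := fun z =>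
  p z || (c z && decide (OnLanes L H z.1 z.2))

/-- The pixels that the robot rewrites when it builds one side. -/
abbrev SideRegion (L i j : ℤ) : Prop :=
  (1 ≤ i ∧ i ≤ L ∧ 1 ≤ j ∧ j ≤ 2) ∨ (L + 1 ≤ i ∧ i ≤ L + 10 ∧ 0 ≤ j ∧ j ≤ 9)

/-- The pixels that the robot rewrites when it builds the next `k` sides. -/
abbrev Undone (k : ℕ) (L H i j : ℤ) : Prop :=
  (1 ≤ k ∧ SideRegion L i j) ∨ (2 ≤ k ∧ SideRegion H (-j) (i - L - 1)) ∨
    (3 ≤ k ∧ SideRegion L (L + 1 - i) (-H - 1 - j)) ∨ (4 ≤ k ∧ SideRegion H (H + 1 + j) (-i))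

/-- There are `k` sides of the box left to be built. -/
structure Pending (k : ℕ) (p c h : Pixel → Bool) (L H : ℤ) : Prop where
  done : ∀ i j : ℤ, ¬ Undone k L H i j → h (i, j) = goal p c L H (i, j)
  one : 1 ≤ k → h (L + 1, 0) = false ∧ h (L + 2, 0) = true ∧ h (L + 1, 1) = true ∧
    h (L + 2, 1) = false
  two : 2 ≤ k → h (L + 1, -H - 1) = false ∧ h (L + 1, -H - 2) = true ∧
    h (L + 2, -H - 1) = true ∧ h (L + 2, -H - 2) = false
  three : 3 ≤ k → h (0, -H - 1) = false ∧ h (-1, -H - 1) = true ∧ h (0, -H - 2) = true ∧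
    h (-1, -H - 2) = false
  four : 4 ≤ k → h (0, 0) = false ∧ h (0, 1) = true ∧ h (-1, 0) = true ∧ h (-1, 1) = false

/-- The grid after the first `n` rows of a side have been built. -/
def withRows (c h : Pixel → Bool) (n : ℤ) : Pixel → Bool := fun z =>
  if 1 ≤ z.1 ∧ z.1 ≤ n ∧ 1 ≤ z.2 ∧ z.2 ≤ 2 then c z else h z

theorem withRows_zero (c h : Pixel → Bool) : withRows c h ((0 : ℕ) : ℤ) = h := by
  ext z
  simp only [withRows]
  rw [if_neg (by omega)]

/-- The grid after a side and the corner at its end have been built. -/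
def withSide (c h : Pixel → Bool) (L H : ℤ) : Pixel → Bool := fun z =>
  if SideRegion L z.1 z.2 then c z && decide (OnLanes L H z.1 z.2) else h z

theorem overwrite_buildRow {e : ℤ} {o : Pixel} {d : Dir} {h : Pixel → Bool} {n : ℤ} (hn : 0 ≤ n) :
    overwrite 11 (n, 0) (buildRow (localChess e o d (n, 0))
      (view 11 (n, 0) (withRows (localChess e o d) h n))) (withRows (localChess e o d) h n) =
      withRows (localChess e o d) h (n + 1) := by
  ext ⟨x, y⟩
  have hxy : ((x, y) : Pixel) = (n + (x - n), 0 + y) := by ext <;> simp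
  by_cases hc : x = n + 1 ∧ 1 ≤ y ∧ y ≤ 2
  · rw [hxy, overwrite_pair (by omega) (by omega) (by omega) (by omega), ← hxy]
    simp only [buildRow, withRows]
    rw [if_pos (by omega), if_pos (by omega), hxy, localChess_add]
  · rw [hxy, overwrite_of_eq_view (by simp only [buildRow]; rw [if_neg (by omega)]), ← hxy]
    simp only [withRows]
    by_cases hc' : 1 ≤ x ∧ x ≤ n ∧ 1 ≤ y ∧ y ≤ 2
    · rw [if_pos hc', if_pos (by omega)]
    · rw [if_neg hc', if_neg (by omega)]

/-- Within the marker block `OnLanes` does not depend on `H`, which the robot cannot see; a fixed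
pattern is therefore enough. -/
theorem overwrite_buildCorner {e : ℤ} {o : Pixel} {d : Dir} {h : Pixel → Bool} {L H : ℤ}
    (hL : 1 ≤ L) (hH : 1 ≤ H) :
    overwrite 11 (L, 0) (buildCorner (localChess e o d (L, 0))
      (view 11 (L, 0) (withRows (localChess e o d) h L))) (withRows (localChess e o d) h L) =
      withSide (localChess e o d) h L H := by
  ext ⟨x, y⟩
  have hxy : ((x, y) : Pixel) = (L + (x - L), 0 + y) := by ext <;> simp
  by_cases hc : L + 1 ≤ x ∧ x ≤ L + 10 ∧ 0 ≤ y ∧ y ≤ 9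
  · rw [hxy, overwrite_pair (by omega) (by omega) (by omega) (by omega), ← hxy]
    simp only [buildCorner, withSide]
    rw [if_pos (by omega), if_pos (by omega)]
    have : localChess e o d (x, y) =
        xor (localChess e o d (L, 0)) (decide (Odd (x - L + y))) := by
      rw [← localChess_add, ← hxy]
    rw [this]
    congr 1
    rw [decide_eq_decide]
    omega
  · rw [hxy, overwrite_of_eq_view (by simp only [buildCorner]; rw [if_neg (by omega)]), ← hxy]
    simp only [withRows, withSide]
    by_cases hc' : 1 ≤ x ∧ x ≤ L ∧ 1 ≤ y ∧ y ≤ 2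
    · rw [if_pos hc', if_pos (.inl hc'), decide_eq_true (by omega), Bool.and_true]
    · rw [if_neg hc', if_neg (by omega)]

section

variable {P : Finset Pixel} {o : Pixel} {d : Dir} {L H : ℕ} {h : Pixel → Bool} {e : ℤ} {k : ℕ}

/-- The turn shifts the regions of `Undone` cyclically and the first one drops out. It contains no
tile of `P` by `Encloses`, so that `goal` asks there for the box only. -/
theorem Pending.turn (hk4 : k < 4) (he : Encloses P o d L H)
    (hp : Pending (k + 1) (localTiles P o d) (localChess e o d) h L H) :
    Pending k (localTiles P (o + d.rot (L + 1, 0)) d.turn)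
      (localChess e (o + d.rot (L + 1, 0)) d.turn)
      (withSide (localChess e o d) h L H ∘ turnAt (L + 1, 0)) H L := by
  rw [localTiles_turn, localChess_turn]
  have hsame : ∀ i j : ℤ, ¬ SideRegion L i j →
      withSide (localChess e o d) h L H (i, j) = h (i, j) := fun i j hij => if_neg hij
  constructor
  · intro i j hij
    have hl : OnLanes H L i j ↔ OnLanes L H (L + 1 + j) (0 - i) := by omega
    simp only [Function.comp, turnAt, goal, hl]
    by_cases hc : SideRegion L (L + 1 + j) (0 - i)
    · simp only [withSide]
      rw [if_pos hc]
      cases ht : localTiles P o d (L + 1 + j, 0 - i) with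
      | false => simp
      | true =>
        have := he _ _ ht
        omega
    · rw [hsame _ _ hc]
      refine hp.done _ _ ?_
      rintro (⟨-, h⟩ | ⟨hk, h⟩ | ⟨hk, h⟩ | ⟨hk, h⟩)
      · exact hc h
      · refine hij (.inl ⟨by omega, ?_⟩)
        clear hij hc
        omega
      · refine hij (.inr (.inl ⟨by omega, ?_⟩))
        clear hij hc
        omega
      · refine hij (.inr (.inr (.inl ⟨by omega, ?_⟩)))
        clear hij hc
        omega
  all_goals intro hk
  · obtain ⟨h1, h2, h3, h4⟩ := hp.two (by omega)
    simp only [Function.comp, turnAt]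
    rw [hsame _ _ (by omega), hsame _ _ (by omega), hsame _ _ (by omega), hsame _ _ (by omega)]
    ring_nf at h1 h2 h3 h4 ⊢
    exact ⟨h1, h2, h3, h4⟩
  · obtain ⟨h1, h2, h3, h4⟩ := hp.three (by omega)
    simp only [Function.comp, turnAt]
    rw [hsame _ _ (by omega), hsame _ _ (by omega), hsame _ _ (by omega), hsame _ _ (by omega)]
    ring_nf at h1 h2 h3 h4 ⊢
    exact ⟨h1, h2, h3, h4⟩
  · obtain ⟨h1, h2, h3, h4⟩ := hp.four (by omega)
    simp only [Function.comp, turnAt]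
    rw [hsame _ _ (by omega), hsame _ _ (by omega), hsame _ _ (by omega), hsame _ _ (by omega)]
    ring_nf at h1 h2 h3 h4 ⊢
    exact ⟨h1, h2, h3, h4⟩
  · omega

theorem Pending.controlled (hs : Inside P o d L H)
    (hp : Pending k (localTiles P o d) (localChess e o d) h L H) {n : ℕ} (hn : n ≤ L)
    (q : BotState) {i : ℤ} (h0 : 0 ≤ i) (h1 : i ≤ L + 1) :
    Controlled P (localWorld q o d (i, 0) (withRows (localChess e o d) h n)) := by
  refine controlled_of_ring hs (fun x y hxy => ?_) q h0 h1
  by_cases hr : (-10 ≤ x ∧ x ≤ L + 11 ∧ -H - 11 ≤ y ∧ y ≤ 10) ∧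
      ¬ (1 ≤ x ∧ x ≤ L ∧ -H ≤ y ∧ y ≤ -1)
  · exact .inr hr
  · left
    simp only [withRows] at hxy
    rw [if_neg (by omega), hp.done x y (by omega)] at hxy
    simp only [goal] at hxy
    rw [decide_eq_false (by omega)] at hxy
    simpa using hxy

theorem reach_rows (hs : Inside P o d L H) (he : Encloses P o d L H) (hk : k < 4)
    (hp : Pending (k + 1) (localTiles P o d) (localChess e o d) h L H) (s : Fin 4) (n : ℕ) :
    ∀ i : ℕ, i + n = L → ReachLe bot.step (Controlled P) n
      (localWorld (.build s (localChess e o d (i, 0))) o d (i, 0)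
        (withRows (localChess e o d) h i))
      (localWorld (.build s (localChess e o d (L, 0))) o d (L, 0)
        (withRows (localChess e o d) h L)) := by
  -- The lane that the robot walks on contains neither tiles of `P` nor of the box, whereas the
  -- marker pattern needs a tile two pixels ahead.
  have hlane : ∀ x : ℤ, 1 ≤ x → x ≤ L → h (x, 0) = false := by
    intro x h1 h2
    rw [hp.done x 0 (by omega)]
    simp only [goal]
    rw [decide_eq_false (by omega), Bool.and_false, Bool.or_false]
    by_contra hc
    rw [Bool.not_eq_false] at hc
    have := he _ _ hc
    omega
  induction n with
  | zero =>
    intro i hi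
    obtain rfl : i = L := by omega
    exact .refl (hp.controlled hs le_rfl _ (by omega) (by omega))
  | succ n ih =>
    intro i hi
    refine .cons (hp.controlled hs (by omega) _ (by omega) (by omega)) ?_
      (ih (i + 1) (by omega))
    set W := view 11 ((i : ℤ), 0) (withRows (localChess e o d) h i) with hW
    have hr : rule (.build s (localChess e o d (i, 0))) W =
        some (.build s (!localChess e o d (i, 0)), buildRow (localChess e o d (i, 0)) W, .fwd,
          false) := by
      have : markerAt W 1 = false := by
        rw [hW, markerAt_ahead]
        have : withRows (localChess e o d) h i (i + 2, 0) = false := by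
          simp only [withRows]
          rw [if_neg (by omega)]
          by_cases hi2 : i + 2 ≤ L
          · exact hlane _ (by omega) (by omega)
          · rw [show (i : ℤ) + 2 = L + 1 by omega]
            exact (hp.one (by omega)).1
        simp [this]
      simp [rule, this]
    have hc : localChess e o d (((i + 1 : ℕ) : ℤ), 0) = !localChess e o d (i, 0) := by
      have := localChess_add e o d i 0 1 0
      simpa using this
    rw [bot_step hr, overwrite_buildRow (by omega), hc]
    congr 2

/-- The state after a side of the box has been built. -/
def afterSide (s : Fin 4) (b : Bool) : BotState := if s = 0 then .halt else .build (s - 1) b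

theorem reach_build_side (hs : Inside P o d L H) (he : Encloses P o d L H) (hk : k < 4)
    (hp : Pending (k + 1) (localTiles P o d) (localChess e o d) h L H) (s : Fin 4) :
    ReachLe bot.step (Controlled P) (L + 1)
      (localWorld (.build s (localChess e o d 0)) o d 0 h)
      (localWorld (afterSide s (localChess e (o + d.rot (L + 1, 0)) d.turn 0))
        (o + d.rot (L + 1, 0)) d.turn 0
        (withSide (localChess e o d) h L H ∘ turnAt (L + 1, 0))) := by
  have h1 := reach_rows hs he hk hp s L 0 (by omega)
  rw [withRows_zero] at h1
  refine h1.trans (.cons (hp.controlled hs le_rfl _ (by omega) (by omega)) ?_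
    (.refl ?_))
  · set W := view 11 ((L : ℤ), 0) (withRows (localChess e o d) h L) with hW
    have hr : rule (.build s (localChess e o d (L, 0))) W =
        some (afterSide s (!localChess e o d (L, 0)), buildCorner (localChess e o d (L, 0)) W,
          .fwd, true) := by
      have : markerAt W 1 = true := by
        rw [hW, markerAt_ahead]
        obtain ⟨h1, h2, h3, h4⟩ := hp.one (by omega)
        simp only [withRows]
        rw [if_neg (by omega), if_neg (by omega), if_neg (by omega), if_neg (by omega)]
        simp [h1, h2, h3, h4]
      simp [rule, this, afterSide]
    have hc : localChess e (o + d.rot (L + 1, 0)) d.turn 0 = !localChess e o d (L, 0) := by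
      rw [localChess_turn]
      have := localChess_add e o d L 0 1 0
      simpa [turnAt] using this
    rw [bot_step_turn hr, overwrite_buildCorner (H := H) (by have := hs.hL; omega)
      (by have := hs.hH; omega), hc]
    simp [Act.vec]
  · have := (hp.turn hk he).controlled hs.turn (n := 0) (by omega)
      (afterSide s (localChess e (o + d.rot (L + 1, 0)) d.turn 0)) (i := 0) le_rfl (by omega)
    rwa [withRows_zero] at this

/-- The four regions cover all marker blocks and all box pixels, so outside them the grid already is
as it should be. -/
theorem Placed.pending (hpl : Placed P o d L H h) :
    Pending 4 (localTiles P o d) (localChess e o d) h L H := by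
  have h1 := hpl.marked
  have h2 := hpl.turn.marked
  have h3 := hpl.turn.turn.marked
  constructor
  · intro i j hij
    rw [h1.rest i j (by omega) (by omega) (by omega) (by omega)]
    simp only [goal]
    rw [decide_eq_false (by omega), Bool.and_false, Bool.or_false]
  · intro _
    simpa using h1.finish_marker
  · intro _
    have := h2.finish_marker
    simp only [Function.comp, turnAt] at this
    ring_nf at this ⊢
    exact this
  · intro _
    have := h3.finish_marker
    simp only [Function.comp, turnAt] at this
    ring_nf at this ⊢
    exact this
  · intro _
    obtain ⟨h2, h3, h4, h5⟩ := h1.start_marker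
    simp only [zero_add] at h4 h5
    exact ⟨h2, h4, h3, h5⟩

/-- The construction of the box around the bounding rectangle. -/
theorem reach_box (hpl : Placed P o d L H h) (he : Encloses P o d L H) :
    ∃ o' d' h' e, Inside P o' d' L H ∧ Encloses P o' d' L H ∧
      (∀ z, h' z = goal (localTiles P o' d') (localChess e o' d') L H z) ∧
      ReachLe bot.step (Controlled P) (2 * (L + H) + 4)
        (localWorld (.build 3 true) o d 0 h) (localWorld .halt o' d' 0 h') := by
  -- This colour class contains the robot's pixel, in accordance with the initial bit `true` of
  -- `.build 3 true`.
  have he0 : localChess (o.1 + o.2) o d 0 = true := by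
    simp [localChess, chess]
  have hp := hpl.pending (e := o.1 + o.2)
  have s1 := reach_build_side hpl.toInside he (by omega) hp 3
  have i1 := hpl.toInside.turn
  have hp2 := hp.turn (by omega) he
  have s2 := reach_build_side i1 he.turn (by omega) hp2 2
  have hp3 := hp2.turn (by omega) he.turn
  have s3 := reach_build_side i1.turn he.turn.turn (by omega) hp3 1
  have hp4 := hp3.turn (by omega) he.turn.turn
  have s4 := reach_build_side i1.turn.turn he.turn.turn.turn (by omega) hp4 0
  rw [he0] at s1
  refine ⟨_, _, _, o.1 + o.2, i1.turn.turn.turn, he.turn.turn.turn.turn, fun z => ?_,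
    (((s1.trans s2).trans s3).trans s4).mono (by omega)⟩
  exact (hp4.turn (by omega) he.turn.turn.turn).done z.1 z.2 (by omega)

end

/-! ## The whole construction -/

theorem exists_run {P : Finset Pixel} (hP : IsPolyomino P) {s : Pixel} (hs : s ∈ P) :
    ∃ n ≤ 80 * (width P * height P), ∃ o d L H h e w₀,
      w₀.state = (BotState.init, Dir.up) ∧ w₀.pos = s ∧ (∀ p, w₀.grid p = true ↔ p ∈ P) ∧
      Inside P o d L H ∧ Encloses P o d L H ∧
      (∀ z, h z = goal (localTiles P o d) (localChess e o d) L H z) ∧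
      Reach bot.step (Controlled P) n w₀ (localWorld .halt o d 0 h) := by
  set o : Pixel := s - Dir.up.rot (1, -1) with ho
  set p := localTiles P o .up with hp
  set h₀ := overwrite 11 (1, -1) (setMarkers (view 11 (1, -1) p)) p with hh₀
  have hso : o + Dir.up.rot (1, -1) = s := by simp [ho]
  have hpl : Placed P o .up 1 1 h₀ :=
    { hL := le_rfl
      hH := le_rfl
      sub := by
        intro i j h1 h2 h3 h4
        obtain rfl : i = 1 := by push_cast at h2; omega
        obtain rfl : j = -1 := by push_cast at h3; omega
        rw [hso]
        exact mem_rect_zero hs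
      tile := ⟨1, -1, by simp, by simp, by simp, by simp, by simp [localTiles, hso, hs]⟩
      marked := Marked.setMarkers p }
  have hstart : bot.step (localWorld .init o .up (1, -1) p) =
      some (localWorld (.scan 0 true (p (1, 0))) o .up (((1 : ℕ) : ℤ), 0) h₀) := by
    have hr : rule .init (view 11 (1, -1) p) =
        some (.scan 0 true (p (1, 0)), setMarkers (view 11 (1, -1) p), .out, false) := by
      simp only [rule]
      rw [view_pair (by omega) (by omega) (by omega) (by omega)]
      simp
    rw [bot_step hr]
    simp [Act.vec]
    rfl
  have hgrid : ∀ q, (localWorld .init o .up (1, -1) p).grid q = true ↔ q ∈ P := by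
    intro q
    simp [localWorld, hp, localTiles]
  have hctrl : Controlled P (localWorld .init o .up (1, -1) p) := by
    refine ⟨?_, ∅, by simp, fun q hq => .inl ((hgrid q).1 hq)⟩
    have := mem_rect_zero hs
    simp only [localWorld, hso]
    simp only [rect, Set.mem_ofPred_eq] at this ⊢
    omega
  -- The first phase counts as productive, since nothing is known yet about the other two lanes; so
  -- a second phase always follows.
  obtain ⟨o1, h1, m, p1, c1, c2, -, r1⟩ := reach_phase hP hpl true (p (1, 0)) (i := 1) le_rfl (by
    constructor
    · intro h
      exact ⟨1, by simp, by simp, h⟩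
    · rintro ⟨x, h3, h4, h5⟩
      obtain rfl : x = 1 := by push_cast at h4; omega
      exact h5)
  have hle := p1.le_span
  simp only [Dir.turn, Dir.span] at hle
  -- Only the width has grown so far, from `1` to `1 + m`. The smaller dimension then bounds the
  -- number of further phases.
  obtain ⟨o2, d2, L, H, h2, p2, k1, k2, k3, k4, r2⟩ := reach_rectangle hP
    (2 * min (width P) (height P) + 2) o1 _ _ _ (height P - 1) (width P - (1 + m)) h1 p1 c1 c2
    (by simp only [Dir.turn, Dir.span]; omega) (by simp only [Dir.turn, Dir.span]; omega)
    (by omega)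
  have he := p2.encloses hP k1 k2 k3 k4
  obtain ⟨o3, d3, h3, e, i3, e3, g3, r3⟩ := reach_box p2 he
  have hle2 := p2.le_span
  have hsum := span_add_span d2 P
  obtain ⟨n, hn, hr⟩ := ReachLe.cons hctrl hstart ((r1.trans r2).trans r3)
  refine ⟨n, hn.trans ?_, o3, d3, L, H, h3, e, _, rfl, hso, hgrid, i3, e3, g3, hr⟩
  simp only [Dir.turn, Dir.span]
  generalize width P = w at *
  generalize height P = v at *
  obtain ⟨w, rfl⟩ := Nat.exists_eq_add_of_le' (show 1 ≤ w by omega)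
  obtain ⟨v, rfl⟩ := Nat.exists_eq_add_of_le' (show 1 ≤ v by omega)
  have hb : (v + 1) * (w + 1 - (1 + m)) ≤ (v + 1) * (w + 1) := Nat.mul_le_mul_left _ (by omega)
  -- This makes the overhead of all phases linear in the area.
  have hmin : (w + 1 + (v + 1)) * min (w + 1) (v + 1) ≤ 2 * ((w + 1) * (v + 1)) := by
    rcases le_total w v with h | h
    · rw [min_eq_left (by omega)]; nlinarith
    · rw [min_eq_right (by omega)]; nlinarith
  rw [Nat.add_sub_cancel]
  nlinarith

/-! ### The enclosing local rectangle is the bounding rectangle -/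

section Extremes

variable {P : Finset Pixel}

theorem exists_extremes (hP : P.Nonempty) : (∃ t ∈ P, t.1 = xMin P) ∧ (∃ t ∈ P, t.1 = xMax P) ∧
    (∃ t ∈ P, t.2 = yMin P) ∧ (∃ t ∈ P, t.2 = yMax P) := by
  have h1 : ((Prod.fst '' (P : Set Pixel)) : Set ℤ).Finite := P.finite_toSet.image _
  have h2 : ((Prod.snd '' (P : Set Pixel)) : Set ℤ).Finite := P.finite_toSet.image _
  have hP' : (P : Set Pixel).Nonempty := hP
  exact ⟨Int.csInf_mem (hP'.image _) h1.bddBelow, Int.csSup_mem (hP'.image _) h1.bddAbove,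
    Int.csInf_mem (hP'.image _) h2.bddBelow, Int.csSup_mem (hP'.image _) h2.bddAbove⟩

theorem width_eq (hP : P.Nonempty) : (width P : ℤ) = xMax P - xMin P + 1 ∧
    (height P : ℤ) = yMax P - yMin P + 1 := by
  obtain ⟨t, ht⟩ := hP
  have := mem_rect_zero ht
  simp only [rect, Set.mem_ofPred_eq] at this
  simp only [width, height]
  omega

/-- A local rectangle that is inside the bounding rectangle and encloses `P` is the bounding
rectangle. -/
theorem mem_rect_iff {o : Pixel} {d : Dir} {L H : ℕ} (hs : Inside P o d L H)
    (he : Encloses P o d L H) (i j : ℤ) :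
    (∀ k, o + d.rot (i, j) ∈ rect P k ↔ 1 - k ≤ i ∧ i ≤ L + k ∧ -H - k ≤ j ∧ j ≤ k - 1) ∧
    (IsOuterCorner P (o + d.rot (i, j)) ↔ (i = -2 ∨ i = L + 3) ∧ (j = 2 ∨ j = -H - 3)) := by
  have hne : P.Nonempty := by
    obtain ⟨x, y, -, -, -, -, h⟩ := hs.tile
    exact ⟨_, by simpa [localTiles] using h⟩
  have hloc : ∀ q ∈ P, ∃ x y : ℤ, q = o + d.rot (x, y) ∧ 1 ≤ x ∧ x ≤ L ∧ -H ≤ y ∧ y ≤ -1 := by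
    intro q hq
    obtain ⟨⟨x, y⟩, rfl⟩ := exists_local o d q
    exact ⟨x, y, rfl, he x y (by simpa [localTiles] using hq)⟩
  -- Extremal tiles lie in the local rectangle, so the bounding rectangle is not larger; the two
  -- corner pixels `g1` and `g2` below give the converse.
  obtain ⟨⟨t1, m1, e1⟩, ⟨t2, m2, e2⟩, ⟨t3, m3, e3⟩, ⟨t4, m4, e4⟩⟩ := exists_extremes hne
  obtain ⟨x1, y1, rfl, f1⟩ := hloc _ m1
  obtain ⟨x2, y2, rfl, f2⟩ := hloc _ m2
  obtain ⟨x3, y3, rfl, f3⟩ := hloc _ m3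
  obtain ⟨x4, y4, rfl, f4⟩ := hloc _ m4
  have hL := hs.hL
  have hH := hs.hH
  have g1 := hs.sub 1 (-1) (by omega) (by omega) (by omega) (by omega)
  have g2 := hs.sub L (-H) (by omega) (by omega) (by omega) (by omega)
  clear hloc m1 m2 m3 m4 hs he
  cases d <;> simp only [rect, Dir.rot, Set.mem_ofPred_eq, Prod.fst_add, Prod.snd_add,
    IsOuterCorner] at * <;> refine ⟨fun k => ?_, ?_⟩ <;> omega

end Extremes

/-! ## The box encloses the polyomino -/

theorem exists_crossing {S : Set Pixel} {p q : Pixel} (W : gridGraph.Walk p q) (hp : p ∈ S)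
    (hq : q ∉ S) : ∃ r ∈ W.support, ∃ r' ∈ W.support, r ∈ S ∧ r' ∉ S ∧ gridGraph.Adj r r' := by
  induction W with
  | nil => exact absurd hp hq
  | @cons a b c hadj W ih =>
    by_cases hb : b ∈ S
    · obtain ⟨r, h1, r', h2, h3⟩ := ih hb hq
      exact ⟨r, by simp [h1], r', by simp [h2], h3⟩
    · exact ⟨a, by simp, b, by simp, hp, hb, hadj⟩

/-- A walk to the exterior steps from the inner to the outer lane, and not onto an outer corner,
which has no neighbour in `rect P 2`. The two pixels of this step have opposite colours, so one is
in `B`. -/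
theorem isZigZagBoundingBox {P B : Finset Pixel} {e : ℤ} (hB : ∀ p : Pixel, p ∈ B ↔
    (p ∈ innerLane P ∨ p ∈ outerLane P ∧ ¬ IsOuterCorner P p) ∧ Even (p.1 + p.2 + e)) :
    IsZigZagBoundingBox P B := by
  refine ⟨⟨e, hB⟩, fun p hp q hq W => ?_⟩
  have hp0 := mem_rect_zero hp
  obtain ⟨r, h1, r', h2, h3, h4, h5⟩ := exists_crossing (S := rect P 2) W
    (by simp only [rect, Set.mem_ofPred_eq] at hp0 ⊢; omega)
    (by simp only [rect, Set.mem_ofPred_eq] at hq ⊢; omega)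
  rw [gridGraph_adj, abs_eq_max_neg, abs_eq_max_neg] at h5
  have hpar : Even (r.1 + r.2 + e) ∨ Even (r'.1 + r'.2 + e) := by
    simp only [Int.even_iff]
    omega
  rcases hpar with h | h
  · refine ⟨r, h1, (hB r).2 ⟨.inl ⟨h3, ?_⟩, h⟩⟩
    simp only [rect, Set.mem_ofPred_eq] at h3 h4 ⊢
    omega
  · refine ⟨r', h2, (hB r').2 ⟨.inr ⟨⟨?_, h4⟩, ?_⟩, h⟩⟩
    · simp only [rect, Set.mem_ofPred_eq] at h3 h4 ⊢
      omega
    · simp only [rect, Set.mem_ofPred_eq, IsOuterCorner] at h3 h4 ⊢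
      omega

/-- The final arrangement of the tiles. -/
theorem exists_box {P : Finset Pixel} {o : Pixel} {d : Dir} {L H : ℕ} {e : ℤ}
    (hs : Inside P o d L H) (he : Encloses P o d L H) {T : Finset Pixel}
    (hT : ∀ q, q ∈ T ↔ goal (localTiles P o d) (localChess e o d) L H (d.rot (q - o)) = true) :
    ∃ B : Finset Pixel, IsZigZagBoundingBox P B ∧ T = P ∪ B := by
  classical
  have hbox : ∀ q : Pixel, (q ∈ innerLane P ∨ q ∈ outerLane P ∧ ¬ IsOuterCorner P q) ↔
      OnLanes L H (d.rot (q - o)).1 (d.rot (q - o)).2 := by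
    intro q
    obtain ⟨⟨i, j⟩, rfl⟩ := exists_local o d q
    obtain ⟨h1, h2⟩ := mem_rect_iff hs he i j
    simp only [innerLane, outerLane, Set.mem_sdiff, h1, h2, add_sub_cancel_left, Dir.rot_rot]
    have := hs.hL
    have := hs.hH
    omega
  have hgoal : ∀ q, q ∈ T ↔ q ∈ P ∨
      ((q ∈ innerLane P ∨ q ∈ outerLane P ∧ ¬ IsOuterCorner P q) ∧ Even (q.1 + q.2 + e)) := by
    intro q
    rw [hT, hbox]
    simp only [goal, localTiles, localChess, chess, Dir.rot_rot, add_sub_cancel,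
      Bool.or_eq_true, Bool.and_eq_true, decide_eq_true_iff]
    exact or_congr_right and_comm
  have hB : ∀ q : Pixel, q ∈ T.filter (fun q =>
      (q ∈ innerLane P ∨ q ∈ outerLane P ∧ ¬ IsOuterCorner P q) ∧ Even (q.1 + q.2 + e)) ↔
      (q ∈ innerLane P ∨ q ∈ outerLane P ∧ ¬ IsOuterCorner P q) ∧ Even (q.1 + q.2 + e) := by
    intro q
    rw [Finset.mem_filter]
    exact ⟨And.right, fun h => ⟨(hgoal q).2 (.inr h), h⟩⟩
  refine ⟨_, isZigZagBoundingBox hB, ?_⟩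
  ext q
  rw [Finset.mem_union, hB]
  exact hgoal q

/-! ## The size of the boundary -/

/-- `f` and `g` stand for the two coordinates in either order. By connectedness `f` takes the value
`x` on `P`; a tile with this value and maximal `g` has an empty neighbour in direction `u`. -/
theorem exists_mem_boundary {P : Finset Pixel} (hP : IsPolyomino P) (f g : Pixel → ℤ)
    (u : Pixel → Pixel) (hf : ∀ p q, gridGraph.Adj p q → f q ≤ f p + 1)
    (hu : ∀ p, gridGraph.Adj p (u p) ∧ f (u p) = f p ∧ g (u p) = g p + 1)
    {a b : Pixel} (ha : a ∈ P) (hb : b ∈ P) {x : ℤ} (hax : f a ≤ x) (hxb : x ≤ f b) :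
    ∃ p ∈ boundary P, f p = x := by
  have hex : (P.filter fun p => f p = x).Nonempty := by
    by_contra hc
    rw [Finset.not_nonempty_iff_eq_empty, Finset.filter_eq_empty_iff] at hc
    have := hP.induct (fun p => f p < x) ha (lt_of_le_of_ne hax (hc ha))
      (fun p _ q hq hadj h => lt_of_le_of_ne (by have := hf p q hadj; omega) (hc hq)) b hb
    omega
  obtain ⟨p, hp, hmax⟩ := Finset.exists_max_image _ g hex
  rw [Finset.mem_filter] at hp
  obtain ⟨h1, h2, h3⟩ := hu p
  refine ⟨p, ?_, hp.2⟩
  simp only [boundary, Finset.mem_filter]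
  refine ⟨hp.1, u p, fun h => ?_, .inl h1⟩
  have := hmax (u p) (Finset.mem_filter.2 ⟨h, by rw [h2, hp.2]⟩)
  omega

theorem card_boundary {P : Finset Pixel} (hP : IsPolyomino P) :
    width P ≤ (boundary P).card ∧ height P ≤ (boundary P).card := by
  obtain ⟨⟨s, hs⟩⟩ := hP.connected.nonempty
  obtain ⟨⟨t1, m1, e1⟩, ⟨t2, m2, e2⟩, ⟨t3, m3, e3⟩, ⟨t4, m4, e4⟩⟩ := exists_extremes ⟨s, hs⟩
  constructor
  · calc width P = (Finset.Icc (xMin P) (xMax P)).card := by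
          rw [Int.card_Icc, width]; congr 1; ring
      _ ≤ ((boundary P).image Prod.fst).card := by
          refine Finset.card_le_card fun x hx => ?_
          rw [Finset.mem_Icc] at hx
          obtain ⟨p, hp, rfl⟩ := exists_mem_boundary hP Prod.fst Prod.snd
            (fun p => (p.1, p.2 + 1)) (fun p q h => by
              rw [gridGraph_adj, abs_eq_max_neg, abs_eq_max_neg] at h; omega)
            (fun p => ⟨by simp [gridGraph_adj], rfl, rfl⟩) m1 m2 (x := x) (by omega) (by omega)
          exact Finset.mem_image_of_mem _ hp
      _ ≤ _ := Finset.card_image_le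
  · calc height P = (Finset.Icc (yMin P) (yMax P)).card := by
          rw [Int.card_Icc, height]; congr 1; ring
      _ ≤ ((boundary P).image Prod.snd).card := by
          refine Finset.card_le_card fun x hx => ?_
          rw [Finset.mem_Icc] at hx
          obtain ⟨p, hp, rfl⟩ := exists_mem_boundary hP Prod.snd Prod.fst
            (fun p => (p.1 + 1, p.2)) (fun p q h => by
              rw [gridGraph_adj, abs_eq_max_neg, abs_eq_max_neg] at h; omega)
            (fun p => ⟨by simp [gridGraph_adj], rfl, rfl⟩) m3 m4 (x := x) (by omega) (by omega)
          exact Finset.mem_image_of_mem _ hp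
      _ ≤ _ := Finset.card_image_le

/-! ## Space and tile bounds for the simulating robot -/

/-- As `1`, the width and the height are at most the size of the boundary, `22 * (w + h) + 484` is
at most `528` times that size. The square counts the window in which the simulation is under way. -/
theorem card_tiles_le {P : Finset Pixel} (hP : IsPolyomino P) {Q : Type} {N : ℕ} {c : Config Q}
    {w : World (BotState × Dir)} (hw : Controlled P w) (hc : WindowRobot.Near N c w) :
    c.tiles.card ≤ P.card + (528 + (2 * N + 1) ^ 2) * (boundary P).card := by
  obtain ⟨-, S, hS, hg⟩ := hw
  have hsub : c.tiles ⊆ P ∪ S ∪ (window N).image (fun z => z + w.pos) := by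
    intro q hq
    simp only [Finset.mem_union, Finset.mem_image]
    rcases hc.tiles q hq with h | h
    · exact .inl (hg q h)
    · exact .inr ⟨_, h, by simp⟩
  have hwin : (window N).card = (2 * N + 1) ^ 2 := by
    have : window (N : ℤ) = Finset.Icc (-N : ℤ) N ×ˢ Finset.Icc (-N : ℤ) N := by
      ext z
      simp only [mem_window, Finset.mem_product, Finset.mem_Icc]
      tauto
    rw [this, Finset.card_product, Int.card_Icc,
      show ((N : ℤ) + 1 - -N).toNat = 2 * N + 1 by omega, sq]
  have h1 := Finset.card_le_card hsub
  have h2 := Finset.card_union_le (P ∪ S) ((window N).image (fun z => z + w.pos))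
  have h3 := Finset.card_union_le P S
  have h4 := (Finset.card_image_le (s := window N) (f := fun z => z + w.pos))
  obtain ⟨h5, h6⟩ := card_boundary hP
  have h7 : 1 ≤ (boundary P).card := by
    obtain ⟨⟨s, hs⟩⟩ := hP.connected.nonempty
    have := (width_eq ⟨s, hs⟩).1
    have h8 := mem_rect_zero hs
    simp only [rect, Set.mem_ofPred_eq] at h8
    omega
  have := Nat.mul_le_mul_left ((2 * N + 1) ^ 2) h7
  rw [hwin] at h4
  linarith

/-- All positions lie in the bounding rectangle enlarged by `N + 1`, which has `(2 * N + 2) * (w +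
h) + (2 * N + 2) ^ 2` pixels more. -/
theorem encard_extraSpace_le {P : Finset Pixel} (hP : IsPolyomino P) {Q : Type} {M : Robot Q}
    {s : Pixel} {N : ℕ}
    (h : ∀ t, ∃ w, Controlled P w ∧ WindowRobot.Near N (M.run P s t) w) :
    (M.extraSpace P s).encard ≤
      (((2 * N + 2) + (2 * N + 2) ^ 2) * (width P + height P) : ℕ) := by
  obtain ⟨⟨s₀, hs₀⟩⟩ := hP.connected.nonempty
  obtain ⟨hw, hh⟩ := width_eq ⟨s₀, hs₀⟩
  have hr := mem_rect_zero hs₀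
  simp only [rect, Set.mem_ofPred_eq] at hr
  set A := Finset.Icc (xMin P - (N + 1)) (xMax P + (N + 1)) ×ˢ
    Finset.Icc (yMin P - (N + 1)) (yMax P + (N + 1)) with hA
  set A₀ := Finset.Icc (xMin P) (xMax P) ×ˢ Finset.Icc (yMin P) (yMax P) with hA₀
  have hsub : M.extraSpace P s ⊆ ((A \ A₀ : Finset Pixel) : Set Pixel) := by
    rintro q ⟨hq, t, rfl⟩
    obtain ⟨w, ⟨hw, -⟩, ⟨h1, h2⟩, -⟩ := h t
    rw [abs_le] at h1 h2
    simp only [rect, Set.mem_ofPred_eq] at hw hq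
    simp only [hA, hA₀, Finset.coe_sdiff, Set.mem_sdiff, Finset.mem_coe, Finset.mem_product,
      Finset.mem_Icc]
    omega
  refine (Set.encard_le_encard hsub).trans ?_
  rw [Set.encard_coe_eq_coe_finsetCard, Nat.cast_le, Finset.card_sdiff_of_subset]
  · simp only [hA, hA₀, Finset.card_product, Int.card_Icc]
    rw [show (xMax P + (N + 1) + 1 - (xMin P - (N + 1))).toNat = width P + (2 * N + 2) by omega,
      show (yMax P + (N + 1) + 1 - (yMin P - (N + 1))).toNat = height P + (2 * N + 2) by omega,
      show (xMax P + 1 - xMin P).toNat = width P by omega,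
      show (yMax P + 1 - yMin P).toNat = height P by omega, Nat.sub_le_iff_le_add]
    have : 1 ≤ width P + height P := by omega
    nlinarith [Nat.mul_le_mul_left ((2 * N + 2) ^ 2) this]
  · intro z
    simp only [hA, hA₀, Finset.mem_product, Finset.mem_Icc]
    omega

theorem theorem1 :
    ∃ (Q : Type) (_ : Finite Q) (M : Robot Q) (C : ℕ),
      ∀ P : Finset Pixel, IsPolyomino P →
        (∀ s ∈ P,
          (∃ T : ℕ, T ≤ C * (max (width P) (height P) * (width P * height P)) ∧
            M.HaltedAt P s T ∧
            ∃ B : Finset Pixel, IsZigZagBoundingBox P B ∧ (M.run P s T).tiles = P ∪ B) ∧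
          (∀ t : ℕ, (M.run P s t).tiles.card ≤ P.card + C * (boundary P).card) ∧
          (M.extraSpace P s).encard ≤ ((C * (width P + height P) : ℕ) : ℕ∞)) ∧
        (∃ s ∈ P, ∃ T : ℕ, T ≤ C * (width P * height P) ∧ M.HaltedAt P s T) := by
  obtain ⟨Q, hQ, M, N, hM⟩ := bot.exists_robot (BotState.init, Dir.up)
  refine ⟨Q, hQ, M, N * 81 + (528 + (2 * N + 1) ^ 2) + ((2 * N + 2) + (2 * N + 2) ^ 2), ?_⟩
  intro P hP
  -- Since the area is at least 1, `80 * (w * h) + 1 ≤ 81 * (w * h)`. The bound holds for every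
  -- start tile, so any tile witnesses the best case.
  have key : ∀ s ∈ P, ∃ T ≤ N * 81 * (width P * height P), M.HaltedAt P s T ∧
      (∃ B : Finset Pixel, IsZigZagBoundingBox P B ∧ (M.run P s T).tiles = P ∪ B) ∧
      ∀ t, ∃ w, Controlled P w ∧ WindowRobot.Near N (M.run P s t) w := by
    intro s hs
    obtain ⟨n, hn, o, d, L, H, h, e, w₀, h1, h2, h3, h4, h5, h6, h7⟩ := exists_run hP hs
    obtain ⟨T, hT, t1, t2, t3⟩ := hM _ P s n w₀ _ h1 h2 h3 h7 (bot_step_halt _ _ _ _)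
    refine ⟨T, hT.trans ?_, t1, exists_box h4 h5 (e := e) fun q => ?_, t3⟩
    · have : 1 ≤ width P * height P := by
        obtain ⟨a1, a2⟩ := width_eq ⟨s, hs⟩
        have a3 := mem_rect_zero hs
        simp only [rect, Set.mem_ofPred_eq] at a3
        exact Nat.mul_pos (by omega) (by omega)
      rw [mul_assoc]
      exact Nat.mul_le_mul_left _ (by omega)
    · rw [t2, ← h6]
      rfl
  have hmax : width P * height P ≤ max (width P) (height P) * (width P * height P) := by
    rcases Nat.eq_zero_or_pos (max (width P) (height P)) with h | h
    · have : width P = 0 := by omega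
      simp [this]
    · exact Nat.le_mul_of_pos_left _ h
  refine ⟨fun s hs => ?_, ?_⟩
  · obtain ⟨T, hT, t1, t2, t3⟩ := key s hs
    refine ⟨⟨T, hT.trans (Nat.mul_le_mul (by omega) hmax), t1, t2⟩, fun t => ?_, ?_⟩
    · obtain ⟨w, hw, hn⟩ := t3 t
      refine (card_tiles_le hP hw hn).trans (Nat.add_le_add_left ?_ _)
      exact Nat.mul_le_mul_right _ (by omega)
    · refine (encard_extraSpace_le hP t3).trans ?_
      exact_mod_cast Nat.mul_le_mul_right _ (by omega)
  · obtain ⟨⟨s, hs⟩⟩ := hP.connected.nonempty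
    obtain ⟨T, hT, t1, -⟩ := key s hs
    exact ⟨s, hs, T, hT.trans (Nat.mul_le_mul_right _ (by omega)), t1⟩
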